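/- **Theorem.** A *shell* is a pair $(\nu,j)$ with $j\in\{0,\tfrac12,1,\dots\}$ and $\nu$ a label for additional quantum numbers; it has $2j+1$ single-particle states $m=-j,\dots,j$. Consider the fermionic Fock space over the single-particle states of a finite set of shells, with vacuum $|0\rangle$, creation operators $a^\dagger_{\nu jm}$ and total angular momentum operators $\hat J_\mu=\sum_{(\nu,j)}\sum_{m',m}\langle jm'|J_\mu|jm\rangle\,a^\dagger_{\nu jm'}a_{\nu jm}$, and put $\hat R(\alpha,\beta,\gamma)=e^{-i\alpha \hat J_z}e^{-i\beta \hat J_y}e^{-i\gamma \hat J_z}$, $$\hat P^J_{M'M}=\frac{2J+1}{8\pi^2}\int_0^{2\pi}\!d\alpha\int_0^{\pi}\!\sin\beta\,d\beta\int_0^{2\pi}\!d\gamma\;D^{J}_{M'M}(\alpha,\beta,\gamma)^*\,\hat R(\alpha,\beta,\gamma),$$ where $D^J_{M'M}$ is the Wigner $D$-function, $D^J_{M'M}(\alpha,\beta,\gamma)=\langle JM'|e^{-i\alpha J_z}e^{-i\beta J_y}e^{-i\gamma J_z}|JM\rangle$. Let $(\nu_1,j_1)$ and $(\nu_2,j_2)$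 be two of these shells, with $j_1\ne j_2$, or $j_1=j_2$ and $\nu_1\ne\nu_2$. Let $\phi_1^\dagger,\phi_1'^\dagger$ be products of $s$ creation operators of the first shell and $\phi_2^\dagger,\phi_2'^\dagger$ products of $t$ creation operators of the second shell. Put $|\phi_i\rangle=\phi_i^\dagger|0\rangle$, $|\phi_i'\rangle=\phi_i'^\dagger|0\rangle$, $|\phi\rangle=\phi_1^\dagger\phi_2^\dagger|0\rangle$ and $|\phi'\rangle=\phi_1'^\dagger\phi_2'^\dagger|0\rangle$. Let $M_i$ and $M_i'$ be the sums of the magnetic quantum numbers of the factors of $\phi_i^\dagger$ and $\phi_i'^\dagger$ (so $\hat J_z|\phi_i\rangle=M_i|\phi_i\rangle$ and $\hat J_z|\phi_i'\rangle=M_i'|\phi_i'\rangle$), and let $M=M_1+M_2$, $M'=M_1'+M_2'$. Then for every $J\in\{0,\tfrac12,1,\dots\}$ $$\langle\phi'|\hat P^J_{M'M}|\phi\rangle=\sum_{J_1,J_2}\langle\phi_1'|\hat P^{J_1}_{M_1'M_1}|\phi_1\rangle\,\langle\phi_2'|\hat P^{J_2}_{M_2'M_2}|\phi_2\rangle\,\langle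 J_1M_1'J_2M_2'|JM'\rangle\,\langle J_1M_1J_2M_2|JM\rangle ,$$ where $J_1,J_2$ run over $\{0,\tfrac12,1,\dots\}$, only finitely many terms are nonzero, and $\langle J_1M_1J_2M_2|JM\rangle$ are the Clebsch–Gordan coefficients with the Condon–Shortley phase convention. $D$-functions and Clebsch–Gordan coefficients are zero when one of the states $|JM\rangle$ in them does not exist ($|M|>J$ or $J-M\notin\mathbb Z$), and Clebsch–Gordan coefficients are also zero unless $|J_1-J_2|\le J\le J_1+J_2$ and $J_1+J_2-J\in\mathbb Z$. -/

import Mathlib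

/-! Angular momenta `j, J` and magnetic quantum numbers `m, M` are half-integers.  They are stored
through the integers `2j, 2J : ℕ` and `2m, 2M : ℤ`.  The `2j + 1` magnetic states of an angular
momentum `j` with `n = 2j` are indexed by `k : Fin (n + 1)`, where `k = j + m`. -/

open Matrix

noncomputable section

/-! ### The standard angular momentum matrices -/

/-- Twice the magnetic quantum number `m = k - j` of the `k`-th magnetic state, where `n = 2j`. -/
def twoM (n : ℕ) (k : Fin (n + 1)) : ℤ := 2 * (k : ℤ) - (n : ℤ)

/-- `J_z |j m⟩ = m |j m⟩`. -/
def spinZ (n : ℕ) : Matrix (Fin (n + 1)) (Fin (n + 1)) ℂ :=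
  Matrix.diagonal fun k => (twoM n k : ℂ) / 2

/-- `J_+ |j m⟩ = √((j - m) (j + m + 1)) |j (m + 1)⟩`. -/
def spinPlus (n : ℕ) : Matrix (Fin (n + 1)) (Fin (n + 1)) ℂ :=
  Matrix.of fun l k =>
    if (l : ℕ) = (k : ℕ) + 1 then ((Real.sqrt (((n : ℝ) - (k : ℝ)) * ((k : ℝ) + 1)) : ℝ) : ℂ)
    else 0

/-- `J_- = (J_+)†`. -/
def spinMinus (n : ℕ) : Matrix (Fin (n + 1)) (Fin (n + 1)) ℂ := (spinPlus n)ᴴ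

/-- `J_y = (J_+ - J_-) / (2i)`. -/
def spinY (n : ℕ) : Matrix (Fin (n + 1)) (Fin (n + 1)) ℂ :=
  (1 / (2 * Complex.I)) • (spinPlus n - spinMinus n)

/-- The rotation operator `exp(-iαJ_z) exp(-iβJ_y) exp(-iγJ_z)` with Euler angles `α, β, γ`. -/
def eulerRotation {ι : Type*} [Fintype ι] [DecidableEq ι] (Jz Jy : Matrix ι ι ℂ)
    (α β γ : ℝ) : Matrix ι ι ℂ :=
  NormedSpace.exp ((-Complex.I * (α : ℂ)) • Jz) * NormedSpace.exp ((-Complex.I * (β : ℂ)) • Jy) *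
    NormedSpace.exp ((-Complex.I * (γ : ℂ)) • Jz)

/-- The state `|J M⟩` with `n = 2J` and `M` given as `2M : ℤ`.  It is the zero vector if there is
no such state, that is, unless `|M| ≤ J` and `J - M` is an integer. -/
def ket (n : ℕ) (M : ℤ) : Fin (n + 1) → ℂ := fun k => if twoM n k = M then 1 else 0

/-- The Wigner function `D^J_{M' M}(α, β, γ) = ⟨J M'| R(α, β, γ) |J M⟩`, with `n = 2J`. -/
def wignerD (n : ℕ) (M' M : ℤ) (α β γ : ℝ) : ℂ :=
  star (ket n M') ⬝ᵥ (eulerRotation (spinZ n) (spinY n) α β γ *ᵥ ket n M)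

/-! ### Clebsch–Gordan coefficients (Condon–Shortley phase convention)

`a = 2J₁`, `b = 2J₂`, `c = 2J`. -/

/-- `J` occurs in the coupling of `J₁` and `J₂`: `|J₁ - J₂| ≤ J ≤ J₁ + J₂` and `J₁ + J₂ - J` is an
integer. -/
def Triangle (a b c : ℕ) : Prop :=
  Even (a + b + c) ∧ a ≤ b + c ∧ b ≤ a + c ∧ c ≤ a + b

/-- The total lowering operator `J_- ⊗ 1 + 1 ⊗ J_-` on the tensor product of `J₁` and `J₂`. -/
def coupledMinus (a b : ℕ) :
    Matrix (Fin (a + 1) × Fin (b + 1)) (Fin (a + 1) × Fin (b + 1)) ℂ :=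
  Matrix.kroneckerMap (· * ·) (spinMinus a) 1 + Matrix.kroneckerMap (· * ·) 1 (spinMinus b)

/-- The vector, unique up to a positive factor, with `M₁ + M₂ = J` that is annihilated by `J_+` and
whose component at `M₁ = J₁` is positive: its components are
`(-1)^(J₁ - M₁) √((J₁ + M₁)! (J₂ + M₂)! / ((J₁ - M₁)! (J₂ - M₂)!))`. -/
def highestVector (a b c : ℕ) : Fin (a + 1) × Fin (b + 1) → ℂ := fun k =>
  if 2 * ((k.1 : ℕ) + (k.2 : ℕ)) = a + b + c then
    (-1) ^ (a - (k.1 : ℕ)) *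
      ((Real.sqrt ((((k.1 : ℕ).factorial : ℝ) * ((k.2 : ℕ).factorial : ℝ)) /
        (((a - (k.1 : ℕ)).factorial : ℝ) * ((b - (k.2 : ℕ)).factorial : ℝ))) : ℝ) : ℂ)
  else 0

/-- The coupled state `|(J₁ J₂) J M⟩` with `k = J + M`: the normalized highest vector is `|J J⟩`,
and `|J M⟩ = √((J + M)! / ((2J)! (J - M)!)) (J_-)^(J - M) |J J⟩`. -/
def coupledKet (a b c : ℕ) (k : Fin (c + 1)) : Fin (a + 1) × Fin (b + 1) → ℂ :=
  ((Real.sqrt (((k : ℕ).factorial : ℝ) /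
      ((c.factorial : ℝ) * ((c - (k : ℕ)).factorial : ℝ))) : ℝ) : ℂ) •
    ((((Real.sqrt (∑ p, ‖highestVector a b c p‖ ^ 2))⁻¹ : ℝ) : ℂ) •
      ((coupledMinus a b) ^ (c - (k : ℕ)) *ᵥ highestVector a b c))

open Classical in
/-- The Clebsch–Gordan coefficient `⟨J₁ M₁ J₂ M₂ | J M⟩`, with all six arguments doubled.  It is
zero if `J` does not occur in the coupling or if one of the three states does not exist. -/
def clebschGordan (a : ℕ) (M₁ : ℤ) (b : ℕ) (M₂ : ℤ) (c : ℕ) (M : ℤ) : ℂ :=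
  if Triangle a b c then
    ∑ k : Fin (c + 1),
      (star (fun p : Fin (a + 1) × Fin (b + 1) => ket a M₁ p.1 * ket b M₂ p.2) ⬝ᵥ
        coupledKet a b c k) * ket c M k
  else 0

/-! ### Fermionic Fock space over finitely many modes, in the occupation number basis -/

section Fock

variable {ι : Type*} [Fintype ι] [LinearOrder ι]

/-- The creation operator `a_i†`: it sends `|T⟩` to `± |T ∪ {i}⟩`, the sign counting the occupied
modes before `i`, and to zero if `i` is already occupied. -/
def create (i : ι) : Matrix (Finset ι) (Finset ι) ℂ :=
  Matrix.of fun T' T => if i ∉ T ∧ T' = insert i T then (-1) ^ (T.filter (· < i)).card else 0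

variable (ι) in
/-- The vacuum `|0⟩`. -/
def vacuum : Finset ι → ℂ := Pi.single ∅ 1

end Fock

/-! ### Shells -/

/-- A `j`-shell, labelled by `2j` and by the collection `ν` of its additional quantum numbers. -/
structure Shell (N : Type*) where
  /-- The additional quantum numbers. -/
  ν : N
  /-- Twice the angular momentum `j`. -/
  twoJ : ℕ

/-- The single-particle states `(ν, j, m)` of a finite set of shells. -/
def Mode {N : Type*} (S : Finset (Shell N)) : Type _ := Σ s : S, Fin (s.1.twoJ + 1)

instance {N : Type*} (S : Finset (Shell N)) : Fintype (Mode S) :=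
  inferInstanceAs (Fintype (Σ s : S, Fin (s.1.twoJ + 1)))

section Shells

variable {N : Type*} (S : Finset (Shell N)) [LinearOrder (Mode S)]

/-- The creation operator of the single-particle state with magnetic index `k` in the shell `s`. -/
def createIn (s : S) (k : Fin (s.1.twoJ + 1)) : Matrix (Finset (Mode S)) (Finset (Mode S)) ℂ :=
  create (ι := Mode S) ⟨s, k⟩

/-- The annihilation operator of the same single-particle state. -/
def annihilateIn (s : S) (k : Fin (s.1.twoJ + 1)) :
    Matrix (Finset (Mode S)) (Finset (Mode S)) ℂ :=
  (createIn S s k)ᴴ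

/-- The second-quantized form `∑_s ∑_{m', m} ⟨j m'| A |j m⟩ a†_{s m'} a_{s m}` of a one-body
operator that acts within each shell through the matrix `A (2j)`. -/
def secondQuantized (A : (n : ℕ) → Matrix (Fin (n + 1)) (Fin (n + 1)) ℂ) :
    Matrix (Finset (Mode S)) (Finset (Mode S)) ℂ :=
  ∑ s : S, ∑ l : Fin (s.1.twoJ + 1), ∑ k : Fin (s.1.twoJ + 1),
    A s.1.twoJ l k • (createIn S s l * annihilateIn S s k)

/-- The rotation operator `R(α, β, γ)` on Fock space, generated by the total angular momentum. -/
def fockRotation (α β γ : ℝ) : Matrix (Finset (Mode S)) (Finset (Mode S)) ℂ :=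
  eulerRotation (secondQuantized S spinZ) (secondQuantized S spinY) α β γ

/-- The angular momentum projection operator
`P^J_{M' M} = (2J + 1) / (8π²) ∫ dα dβ dγ sin β D^J_{M' M}(α, β, γ)^* R(α, β, γ)`
on Fock space, with `n = 2J`; the integral is taken entry by entry. -/
def projection (n : ℕ) (M' M : ℤ) : Matrix (Finset (Mode S)) (Finset (Mode S)) ℂ :=
  Matrix.of fun T' T =>
    (((n : ℂ) + 1) / (8 * (Real.pi : ℂ) ^ 2)) *
      ∫ α in (0 : ℝ)..(2 * Real.pi), ∫ β in (0 : ℝ)..Real.pi, ∫ γ in (0 : ℝ)..(2 * Real.pi),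
        (Real.sin β : ℂ) * star (wignerD n M' M α β γ) * fockRotation S α β γ T' T

/-- The operator `φ† = a†_{s, m_1} ⋯ a†_{s, m_p}` creating `p` particles in the shell `s`. -/
def creator (s : S) {p : ℕ} (m : Fin p → Fin (s.1.twoJ + 1)) :
    Matrix (Finset (Mode S)) (Finset (Mode S)) ℂ :=
  (List.ofFn fun i => createIn S s (m i)).prod

/-- The Fock space state `A |0⟩`. -/
def stateOf (A : Matrix (Finset (Mode S)) (Finset (Mode S)) ℂ) : Finset (Mode S) → ℂ :=
  A *ᵥ vacuum (Mode S)

end Shells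

/-- Twice the total magnetic quantum number `m_1 + ⋯ + m_p`. -/
def totalTwoM {n p : ℕ} (m : Fin p → Fin (n + 1)) : ℤ := ∑ i, twoM n (m i)

/-- The matrix element `⟨ψ| A |φ⟩`. -/
def matrixElement {κ : Type*} [Fintype κ] (ψ : κ → ℂ) (A : Matrix κ κ ℂ) (φ : κ → ℂ) : ℂ :=
  star ψ ⬝ᵥ (A *ᵥ φ)

end

/-! Between eigenvectors of `Ĵ_z` whose eigenvalues are the magnetic numbers of the projector, the
outer Euler exponentials are phases that cancel against those of `D*`. The matrix element of
`P^J_{M'M}` is therefore `(2J+1)/2 ∫ sin β d^J_{M'M}(β)* f(β) dβ` with `f(β) = ⟨φ'|exp(-iβĴ_y)|φ⟩`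
(`matrixElement_projection`): it is the coefficient of `d^J_{M'M}` in `f`. The theorem becomes a
statement about coefficients of a product of two functions.

Three facts carry it. The first is `f = f₁ f₂` (`matrixElement_exp_secondQuantized_mul`): a one-body
exponential transforms each creation operator within its own shell, and overlaps of products over
distinct shells factorize. The second is the Clebsch–Gordan series `reducedWigner_mul`, which
expands `d^{J₁} d^{J₂}` in the functions `d^J`. It follows by inserting the resolution of the
identity made of the coupled multiplets: these are orthonormal because `J_z` and the Casimir
operator separate them, and complete by a dimension count. The third is orthogonality,
`integral_reducedWigner_mul`. Conjugation negates the magnetic numbers, so the series reduces it to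
`∫ sin β d^c_{00}`, which vanishes for `c ≠ 0` by Legendre's equation.

Each `f_i` is a combination of products of single-particle `d`-functions, hence a finite combination
of `d^{J_i}_{M_i'M_i}` by the series, with the projector matrix elements as coefficients by
orthogonality. Multiplying the two expansions and applying the series once more gives the formula
(`wignerCoeff_mul`). -/

noncomputable section

/-! ### Intertwining relations, exponentials and eigenvectors -/

open scoped Kronecker

-- An intertwining relation passes to powers and, multiplication by `U` being continuous and
-- additive, to the exponential series. `U` may be rectangular, so one lemma serves eigenvectors,
-- multiplets, Kronecker sums and rows of creation operators.
open scoped Matrix.Norms.Operator in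
theorem exp_mul_of_mul_eq {ι κ : Type*} [Fintype ι] [DecidableEq ι] [Fintype κ] [DecidableEq κ]
    {A : Matrix ι ι ℂ} {B : Matrix κ κ ℂ} {U : Matrix ι κ ℂ} (h : A * U = U * B) :
    NormedSpace.exp A * U = U * NormedSpace.exp B := by
  have hpow : ∀ n : ℕ, A ^ n * U = U * B ^ n := by
    intro n
    induction n with
    | zero => simp
    | succ n ih => rw [pow_succ, Matrix.mul_assoc, h, ← Matrix.mul_assoc, ih, Matrix.mul_assoc,
        ← pow_succ]
  have hA := (NormedSpace.exp_series_hasSum_exp' (𝕂 := ℂ) A).map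
    (⟨⟨fun X : Matrix ι ι ℂ => X * U, Matrix.zero_mul U⟩, fun X Y => Matrix.add_mul X Y U⟩ :
      Matrix ι ι ℂ →+ Matrix ι κ ℂ) (by exact continuous_id.matrix_mul continuous_const)
  have hB := (NormedSpace.exp_series_hasSum_exp' (𝕂 := ℂ) B).map
    (⟨⟨fun X : Matrix κ κ ℂ => U * X, Matrix.mul_zero U⟩, fun X Y => Matrix.mul_add U X Y⟩ :
      Matrix κ κ ℂ →+ Matrix ι κ ℂ) (by exact continuous_const.matrix_mul continuous_id)
  refine hA.unique ?_
  convert hB using 1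
  · funext n
    simp [hpow]
  · rfl

theorem exp_smul_mulVec_of_mulVec_eq {ι : Type*} [Fintype ι] [DecidableEq ι]
    {A : Matrix ι ι ℂ} {v : ι → ℂ} {μ : ℂ} (h : A *ᵥ v = μ • v) (c : ℂ) :
    NormedSpace.exp (c • A) *ᵥ v = Complex.exp (c * μ) • v := by
  -- The eigenvector, as a one-column matrix, intertwines `c • A` with a 1 × 1 matrix.
  have h1 : (c • A) * Matrix.replicateCol Unit v =
      Matrix.replicateCol Unit v * (Matrix.diagonal (fun _ => c * μ) : Matrix Unit Unit ℂ) := by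
    refine Matrix.ext fun i j => ?_
    have := congrFun h i
    simp only [Matrix.mulVec, dotProduct, Pi.smul_apply, smul_eq_mul] at this
    rw [Matrix.mul_diagonal, Matrix.smul_mul, Matrix.smul_apply, Matrix.mul_apply]
    simp only [Matrix.replicateCol_apply, this, smul_eq_mul]
    ring
  have h2 := exp_mul_of_mul_eq h1
  rw [Matrix.exp_diagonal] at h2
  ext i
  have h3 := congrFun (congrFun h2 i) ()
  rw [Matrix.mul_diagonal, Matrix.mul_apply, Pi.coe_exp, ← Complex.exp_eq_exp_ℂ] at h3
  simp only [Matrix.replicateCol_apply] at h3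
  rw [Matrix.mulVec, dotProduct, h3, Pi.smul_apply, smul_eq_mul, mul_comm]

theorem dotProduct_exp_mulVec_of_mulVec_eq {ι : Type*} [Fintype ι] [DecidableEq ι]
    {A : Matrix ι ι ℂ} (hA : Aᴴ = A) {v : ι → ℂ} {μ : ℝ} (h : A *ᵥ v = (μ : ℂ) • v) (c : ℂ)
    (w : ι → ℂ) :
    star v ⬝ᵥ (NormedSpace.exp (c • A) *ᵥ w) = Complex.exp (c * μ) * (star v ⬝ᵥ w) := by
  have h1 := exp_smul_mulVec_of_mulVec_eq h (star c)
  have h2 : (NormedSpace.exp (star c • A))ᴴ = NormedSpace.exp (c • A) := by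
    rw [← Matrix.exp_conjTranspose]; simp [hA]
  rw [Matrix.dotProduct_mulVec, ← h2, Matrix.vecMul_conjTranspose, star_star, h1, star_smul,
    smul_dotProduct, smul_eq_mul]
  congr 1
  simp [← Complex.exp_conj]

theorem dotProduct_eq_zero_of_mulVec_eq {ι : Type*} [Fintype ι]
    {A : Matrix ι ι ℂ} (hA : Aᴴ = A) {v w : ι → ℂ} {μ ν : ℝ} (hv : A *ᵥ v = (μ : ℂ) • v)
    (hw : A *ᵥ w = (ν : ℂ) • w) (h : μ ≠ ν) : star v ⬝ᵥ w = 0 := by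
  have h1 : star v ⬝ᵥ (A *ᵥ w) = (μ : ℂ) * (star v ⬝ᵥ w) := by
    rw [Matrix.dotProduct_mulVec]
    conv_lhs => rw [← hA]
    rw [Matrix.vecMul_conjTranspose, star_star, hv, star_smul, smul_dotProduct, smul_eq_mul]
    simp
  rw [hw, dotProduct_smul, smul_eq_mul] at h1
  have h2 : ((μ : ℂ) - ν) * (star v ⬝ᵥ w) = 0 := by rw [sub_mul, h1, sub_self]
  rcases mul_eq_zero.1 h2 with h3 | h3
  · exact absurd (by exact_mod_cast sub_eq_zero.1 h3) h
  · exact h3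

/-! ### The spin matrices -/

/-- Taking `f` on `ℕ` avoids a case split at the top state: there `k + 1` is out of range, but the
square root vanishes. -/
theorem sum_mul_spinPlus {n : ℕ} (f : ℕ → ℂ) (k : Fin (n + 1)) :
    ∑ l : Fin (n + 1), f l * spinPlus n l k =
      f (k + 1) * (Real.sqrt (((n : ℝ) - (k : ℝ)) * ((k : ℝ) + 1)) : ℝ) := by
  by_cases hk : (k : ℕ) = n
  · simp only [spinPlus, Matrix.of_apply, hk, sub_self, zero_mul, Real.sqrt_zero]
    simp
  · rw [Finset.sum_eq_single (⟨k + 1, by omega⟩ : Fin (n + 1))]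
    · simp [spinPlus]
    · intro l _ hl
      have : (l : ℕ) ≠ k + 1 := fun h => hl (Fin.ext h)
      simp [spinPlus, this]
    · simp

theorem spinMinus_apply {n : ℕ} (l k : Fin (n + 1)) :
    spinMinus n l k = spinPlus n k l := by
  simp only [spinMinus, Matrix.conjTranspose_apply, spinPlus, Matrix.of_apply]
  split_ifs <;> simp

/-- The truncated `k - 1` at `k = 0` is harmless because of the factor `k` under the root. -/
theorem sum_mul_spinMinus {n : ℕ} (f : ℕ → ℂ) (k : Fin (n + 1)) :
    ∑ l : Fin (n + 1), f l * spinMinus n l k =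
      f (k - 1) * (Real.sqrt (((n : ℝ) - (k : ℝ) + 1) * (k : ℝ)) : ℝ) := by
  simp only [spinMinus_apply]
  by_cases hk : (k : ℕ) = 0
  · rw [Finset.sum_eq_zero]
    · simp [hk]
    · intro l _
      simp [spinPlus, hk]
  · rw [Finset.sum_eq_single (⟨k - 1, by omega⟩ : Fin (n + 1))]
    · have h1 : (k : ℕ) = (k - 1) + 1 := by omega
      simp only [spinPlus, Matrix.of_apply, ← h1, if_true]
      have h2 : (((k : ℕ) - 1 : ℕ) : ℝ) = (k : ℝ) - 1 := by
        rw [Nat.cast_sub (by omega)]; simp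
      rw [h2]
      ring_nf
    · intro l _ hl
      have : (k : ℕ) ≠ l + 1 := fun h => hl (Fin.ext (by simp; omega))
      simp [spinPlus, this]
    · simp

theorem spinZ_isHermitian (n : ℕ) : (spinZ n)ᴴ = spinZ n := by
  simp only [spinZ, Matrix.diagonal_conjTranspose]
  congr 1
  ext k
  simp

theorem spinZ_mul_spinPlus (n : ℕ) :
    spinZ n * spinPlus n - spinPlus n * spinZ n = spinPlus n := by
  ext l k
  simp only [spinZ, Matrix.sub_apply, Matrix.diagonal_mul, Matrix.mul_diagonal, spinPlus,
    Matrix.of_apply]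
  split_ifs with h
  · simp only [twoM, h]
    push_cast
    ring
  · simp

theorem ofReal_sqrt_mul_self {x : ℝ} (hx : 0 ≤ x) :
    ((Real.sqrt x : ℝ) : ℂ) * ((Real.sqrt x : ℝ) : ℂ) = (x : ℂ) := by
  rw [← Complex.ofReal_mul, Real.mul_self_sqrt hx]

theorem spinMinus_mul_spinPlus (n : ℕ) : spinMinus n * spinPlus n =
    Matrix.diagonal fun k : Fin (n + 1) => ((n : ℂ) - (k : ℂ)) * ((k : ℂ) + 1) := by
  ext l k
  have h := sum_mul_spinPlus (fun m => if (m : ℕ) = l + 1 then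
    ((Real.sqrt (((n : ℝ) - (l : ℝ)) * ((l : ℝ) + 1)) : ℝ) : ℂ) else 0) k
  rw [Matrix.mul_apply]
  simp only [spinMinus_apply l]
  refine Eq.trans (by simp only [spinPlus, Matrix.of_apply]) (h.trans ?_)
  rw [Matrix.diagonal_apply]
  by_cases hlk : l = k
  · subst hlk
    have hl : (l : ℝ) ≤ n := by exact_mod_cast Nat.lt_succ_iff.1 l.2
    simp only [if_true]
    rw [ofReal_sqrt_mul_self (mul_nonneg (by linarith) (by positivity))]
    push_cast
    ring
  · have h3 : (l : ℕ) ≠ k := fun h => hlk (Fin.ext h)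
    rw [if_neg hlk, if_neg (by omega), zero_mul]

theorem spinPlus_mul_spinMinus (n : ℕ) :
    spinPlus n * spinMinus n - spinMinus n * spinPlus n = (2 : ℂ) • spinZ n := by
  ext l k
  have h1 := sum_mul_spinMinus (fun m => if (l : ℕ) = m + 1 then
    ((Real.sqrt (((n : ℝ) - (m : ℝ)) * ((m : ℝ) + 1)) : ℝ) : ℂ) else 0) k
  have e1 : (spinPlus n * spinMinus n) l k = _ := h1
  rw [Matrix.sub_apply, e1, spinMinus_mul_spinPlus]
  have hl : (l : ℝ) ≤ n := by exact_mod_cast Nat.lt_succ_iff.1 l.2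
  simp only [Matrix.smul_apply, spinZ, Matrix.diagonal_apply, twoM, smul_eq_mul]
  by_cases hlk : l = k
  · subst hlk
    have h3 : (if (l : ℕ) = l - 1 + 1 then
        ((Real.sqrt (((n : ℝ) - ((l - 1 : ℕ) : ℝ)) * (((l - 1 : ℕ) : ℝ) + 1)) : ℝ) : ℂ) else 0) *
        ((Real.sqrt (((n : ℝ) - (l : ℝ) + 1) * (l : ℝ)) : ℝ) : ℂ) =
        (((n : ℝ) - (l : ℝ) + 1) * (l : ℝ) : ℝ) := by
      by_cases h0 : (l : ℕ) = 0
      · simp [h0]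
      · rw [if_pos (by omega), Nat.cast_sub (by omega),
          ← ofReal_sqrt_mul_self (mul_nonneg (by linarith) (by positivity))]
        push_cast
        ring_nf
    simp only [if_true, h3]
    push_cast
    ring
  · have h3 : (l : ℕ) ≠ k := fun h => hlk (Fin.ext h)
    rw [if_neg hlk, if_neg hlk]
    by_cases h0 : (k : ℕ) = 0
    · simp [h0]
    · rw [if_neg (by omega)]
      simp

/-! ### Highest weight vectors -/

section Ladder

variable {ι : Type*} [Fintype ι]

/-- `P` and `Pᴴ` are the raising and lowering operators of an angular momentum whose
`z`-component is `Z`, and `h` is a highest weight vector of weight `c / 2`. -/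
structure IsHighest (Z P : Matrix ι ι ℂ) (h : ι → ℂ) (c : ℕ) : Prop where
  isHermitian : Zᴴ = Z
  comm_plus : Z * P - P * Z = P
  comm_plus_minus : P * Pᴴ - Pᴴ * P = (2 : ℂ) • Z
  plus_mulVec : P *ᵥ h = 0
  z_mulVec : Z *ᵥ h = ((c : ℂ) / 2) • h

variable {Z P : Matrix ι ι ℂ} {h : ι → ℂ} {c : ℕ}

theorem IsHighest.comm_minus (H : IsHighest Z P h c) : Z * Pᴴ = Pᴴ * Z - Pᴴ := by
  have := congrArg Matrix.conjTranspose H.comm_plus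
  rw [Matrix.conjTranspose_sub, Matrix.conjTranspose_mul, Matrix.conjTranspose_mul,
    H.isHermitian] at this
  exact (sub_eq_of_eq_add (eq_add_of_sub_eq' this)).symm

/-- The squared total angular momentum. -/
def casimir (Z P : Matrix ι ι ℂ) : Matrix ι ι ℂ := Pᴴ * P + Z * Z + Z

theorem IsHighest.casimir_isHermitian (H : IsHighest Z P h c) :
    (casimir Z P)ᴴ = casimir Z P := by
  simp [casimir, Matrix.conjTranspose_mul, H.isHermitian]

theorem star_dotProduct_self (h : ι → ℂ) : star h ⬝ᵥ h = ((∑ p, ‖h p‖ ^ 2 : ℝ) : ℂ) := by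
  simp only [dotProduct, Pi.star_apply]
  push_cast
  refine Finset.sum_congr rfl fun p _ => ?_
  rw [RCLike.star_def, Complex.conj_mul']

variable [DecidableEq ι]

theorem IsHighest.z_pow (H : IsHighest Z P h c) (i : ℕ) :
    Z *ᵥ (Pᴴ ^ i *ᵥ h) = ((c : ℂ) / 2 - i) • (Pᴴ ^ i *ᵥ h) := by
  induction i with
  | zero => simp [H.z_mulVec]
  | succ i ih =>
    rw [pow_succ', ← Matrix.mulVec_mulVec, Matrix.mulVec_mulVec, H.comm_minus, Matrix.sub_mulVec,
      ← Matrix.mulVec_mulVec, ih, Matrix.mulVec_smul]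
    push_cast
    module

/-- Moving `P` past one lowering operator leaves `2Z`; the constant is the sum of the eigenvalues `c
- 2r` of `2Z` over `r ≤ i`. -/
theorem IsHighest.plus_pow_succ (H : IsHighest Z P h c) (i : ℕ) :
    P *ᵥ (Pᴴ ^ (i + 1) *ᵥ h) = (((i : ℂ) + 1) * ((c : ℂ) - i)) • (Pᴴ ^ i *ᵥ h) := by
  have key : P * Pᴴ = Pᴴ * P + (2 : ℂ) • Z := by rw [← H.comm_plus_minus]; abel
  induction i with
  | zero =>
    rw [pow_succ', ← Matrix.mulVec_mulVec, Matrix.mulVec_mulVec, key, Matrix.add_mulVec,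
      ← Matrix.mulVec_mulVec, Matrix.smul_mulVec, H.z_pow]
    simp [H.plus_mulVec, smul_smul]
    congr 1; ring
  | succ i ih =>
    rw [pow_succ', ← Matrix.mulVec_mulVec, Matrix.mulVec_mulVec, key, Matrix.add_mulVec,
      ← Matrix.mulVec_mulVec, Matrix.smul_mulVec, H.z_pow, ih, Matrix.mulVec_smul,
      Matrix.mulVec_mulVec, ← pow_succ', smul_smul, ← add_smul]
    congr 1
    push_cast
    ring

/-- One lowering operator at a time is moved to the other side as `P`. The range reaches `c + 1`,
where the norm is zero, so that the multiplet is seen to end. -/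
theorem IsHighest.norm_pow (H : IsHighest Z P h c) {i : ℕ} (hi : i ≤ c + 1) :
    star (Pᴴ ^ i *ᵥ h) ⬝ᵥ (Pᴴ ^ i *ᵥ h) =
      ((i.factorial * c.descFactorial i : ℕ) : ℂ) * (star h ⬝ᵥ h) := by
  induction i with
  | zero => simp
  | succ i ih =>
    have h1 := H.plus_pow_succ i
    rw [pow_succ', ← Matrix.mulVec_mulVec] at h1
    rw [pow_succ', ← Matrix.mulVec_mulVec, Matrix.star_mulVec, Matrix.conjTranspose_conjTranspose,
      ← Matrix.dotProduct_mulVec, h1, dotProduct_smul, ih (by omega)]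
    rw [Nat.factorial_succ, Nat.descFactorial_succ]
    push_cast
    rw [Nat.cast_sub (by omega), smul_eq_mul]
    ring

open scoped ComplexOrder in
theorem IsHighest.pow_eq_zero (H : IsHighest Z P h c) : Pᴴ ^ (c + 1) *ᵥ h = 0 := by
  have := H.norm_pow le_rfl
  rw [Nat.descFactorial_of_lt (Nat.lt_succ_self c)] at this
  rw [mul_zero, Nat.cast_zero, zero_mul] at this
  exact dotProduct_star_self_eq_zero.1 this

/-- With `z = c/2 - i`, the sum `i(c - i + 1) + z² + z` does not depend on `i`. The eigenvalue is
written as a real cast to fit `dotProduct_eq_zero_of_mulVec_eq`. -/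
theorem IsHighest.casimir_pow (H : IsHighest Z P h c) (i : ℕ) :
    casimir Z P *ᵥ (Pᴴ ^ i *ᵥ h) = (((c : ℝ) / 2 * ((c : ℝ) / 2 + 1) : ℝ) : ℂ) •
      (Pᴴ ^ i *ᵥ h) := by
  have h1 : Pᴴ *ᵥ (P *ᵥ (Pᴴ ^ i *ᵥ h)) = ((i : ℂ) * ((c : ℂ) - i + 1)) • (Pᴴ ^ i *ᵥ h) := by
    cases i with
    | zero => simp [H.plus_mulVec]
    | succ i =>
      rw [H.plus_pow_succ, Matrix.mulVec_smul, Matrix.mulVec_mulVec, ← pow_succ']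
      congr 1
      push_cast
      ring
  rw [casimir, Matrix.add_mulVec, Matrix.add_mulVec, ← Matrix.mulVec_mulVec,
    ← Matrix.mulVec_mulVec, h1, H.z_pow, Matrix.mulVec_smul, H.z_pow, smul_smul, ← add_smul,
    ← add_smul]
  congr 1
  push_cast
  ring

/-- The normalized state `|J M⟩` with `k = J + M` of the multiplet with highest vector `h`. -/
def multiplet (P : Matrix ι ι ℂ) (h : ι → ℂ) (c k : ℕ) : ι → ℂ :=
  ((Real.sqrt ((k.factorial : ℝ) / ((c.factorial : ℝ) * ((c - k).factorial : ℝ))) : ℝ) : ℂ) •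
    ((((Real.sqrt (∑ p, ‖h p‖ ^ 2))⁻¹ : ℝ) : ℂ) • (Pᴴ ^ (c - k) *ᵥ h))

theorem IsHighest.z_multiplet (H : IsHighest Z P h c) {k : ℕ} (hk : k ≤ c) :
    Z *ᵥ multiplet P h c k = (((k : ℝ) - (c : ℝ) / 2 : ℝ) : ℂ) • multiplet P h c k := by
  rw [multiplet, Matrix.mulVec_smul, Matrix.mulVec_smul, H.z_pow, Nat.cast_sub hk]
  push_cast
  module

theorem IsHighest.casimir_multiplet (H : IsHighest Z P h c) (k : ℕ) :
    casimir Z P *ᵥ multiplet P h c k =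
      (((c : ℝ) / 2 * ((c : ℝ) / 2 + 1) : ℝ) : ℂ) • multiplet P h c k := by
  rw [multiplet, Matrix.mulVec_smul, Matrix.mulVec_smul, H.casimir_pow]
  module

/-- The square-root prefactors in `multiplet` are chosen so that the ladder constants become those
of the standard `J_+`. At `k = c` the vector of index `c + 1` is meaningless, but its coefficient is
zero. -/
theorem IsHighest.plus_multiplet (H : IsHighest Z P h c) {k : ℕ} (hk : k ≤ c) :
    P *ᵥ multiplet P h c k =
      ((Real.sqrt (((c : ℝ) - (k : ℝ)) * ((k : ℝ) + 1)) : ℝ) : ℂ) • multiplet P h c (k + 1) := by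
  rcases hk.eq_or_lt with rfl | hk
  · simp [multiplet, Matrix.mulVec_smul, H.plus_mulVec]
  · obtain ⟨i, rfl⟩ := Nat.exists_eq_add_of_lt hk
    have e1 : k + i + 1 - k = i + 1 := by omega
    have e2 : k + i + 1 - (k + 1) = i := by omega
    rw [multiplet, Matrix.mulVec_smul, Matrix.mulVec_smul, multiplet, e1, e2, H.plus_pow_succ,
      smul_smul, smul_smul, smul_smul, smul_smul]
    congr 1
    have e3 : ((k + i + 1 : ℕ) : ℝ) - k = i + 1 := by push_cast; ring
    have e4 : ((k + i + 1 : ℕ) : ℂ) - i = k + 1 := by push_cast; ring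
    have e5 : (((k + 1).factorial : ℝ) / (((k + i + 1).factorial : ℝ) * (i.factorial : ℝ))) =
        (((i : ℝ) + 1) * ((k : ℝ) + 1)) *
        ((k.factorial : ℝ) / (((k + i + 1).factorial : ℝ) * ((i + 1).factorial : ℝ))) := by
      rw [Nat.factorial_succ k, Nat.factorial_succ i]
      push_cast
      field_simp
    rw [e3, e4, e5, Real.sqrt_mul (show 0 ≤ ((i : ℝ) + 1) * ((k : ℝ) + 1) by positivity)]
    have := ofReal_sqrt_mul_self (x := ((i : ℝ) + 1) * ((k : ℝ) + 1)) (by positivity)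
    push_cast at this ⊢
    rw [← this]
    ring

theorem IsHighest.minus_multiplet (H : IsHighest Z P h c) {k : ℕ} (hk : k ≤ c) :
    Pᴴ *ᵥ multiplet P h c k =
      ((Real.sqrt (((c : ℝ) - (k : ℝ) + 1) * (k : ℝ)) : ℝ) : ℂ) • multiplet P h c (k - 1) := by
  rcases Nat.eq_zero_or_pos k with rfl | hk0
  · simp [multiplet, Matrix.mulVec_smul, ← pow_succ', H.pow_eq_zero]
  · obtain ⟨i, rfl⟩ := Nat.exists_eq_add_of_le hk
    obtain ⟨k, rfl⟩ := Nat.exists_eq_add_of_le' hk0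
    have e1 : k + 1 + i - (k + 1) = i := by omega
    have e2 : k + 1 + i - (k + 1 - 1) = i + 1 := by omega
    rw [multiplet, Matrix.mulVec_smul, Matrix.mulVec_smul, multiplet, e1, e2, Matrix.mulVec_mulVec,
      ← pow_succ', smul_smul, smul_smul, smul_smul]
    congr 1
    have e3 : ((k + 1 + i : ℕ) : ℝ) - ((k + 1 : ℕ) : ℝ) = i := by push_cast; ring
    have e5 : (((k + 1).factorial : ℝ) / (((k + 1 + i).factorial : ℝ) * (i.factorial : ℝ))) =
        (((i : ℝ) + 1) * ((k + 1 : ℕ) : ℝ)) *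
        ((k.factorial : ℝ) / (((k + 1 + i).factorial : ℝ) * ((i + 1).factorial : ℝ))) := by
      rw [Nat.factorial_succ k, Nat.factorial_succ i]
      push_cast
      field_simp
    rw [e3, e5, Real.sqrt_mul (by positivity), Nat.add_sub_cancel]
    push_cast
    ring

theorem IsHighest.norm_multiplet (H : IsHighest Z P h c) (h0 : h ≠ 0) {k : ℕ} (hk : k ≤ c) :
    star (multiplet P h c k) ⬝ᵥ multiplet P h c k = 1 := by
  have hpos : 0 < ∑ p, ‖h p‖ ^ 2 := by
    obtain ⟨p, hp⟩ := Function.ne_iff.1 h0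
    exact Finset.sum_pos' (fun _ _ => by positivity)
      ⟨p, Finset.mem_univ _, pow_pos (norm_pos_iff.2 hp) 2⟩
  obtain ⟨i, rfl⟩ := Nat.exists_eq_add_of_le hk
  have e1 : k + i - k = i := by omega
  rw [multiplet, e1]
  simp only [star_smul, smul_dotProduct, dotProduct_smul, H.norm_pow (show i ≤ k + i + 1 by omega),
    smul_eq_mul, RCLike.star_def, Complex.conj_ofReal, star_dotProduct_self]
  -- The norm of the lowered vector is exactly what the factorial prefactor cancels.
  have e2 : k.factorial * (k + i).descFactorial i = (k + i).factorial := by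
    have := Nat.factorial_mul_descFactorial (show i ≤ k + i by omega)
    rwa [Nat.add_sub_cancel] at this
  have s1 := ofReal_sqrt_mul_self (x := (k.factorial : ℝ) / (((k + i).factorial : ℝ) *
    (i.factorial : ℝ))) (by positivity)
  have s2 := ofReal_sqrt_mul_self hpos.le
  have s3 : ((Real.sqrt (∑ p, ‖h p‖ ^ 2) : ℝ) : ℂ) ≠ 0 := by
    exact_mod_cast (Real.sqrt_pos.2 hpos).ne'
  calc _ = (((Real.sqrt ((k.factorial : ℝ) / (((k + i).factorial : ℝ) *
        (i.factorial : ℝ))) : ℝ) : ℂ) * ((Real.sqrt ((k.factorial : ℝ) / (((k + i).factorial : ℝ) *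
        (i.factorial : ℝ))) : ℝ) : ℂ)) * (((Real.sqrt (∑ p, ‖h p‖ ^ 2))⁻¹ : ℝ) *
        ((Real.sqrt (∑ p, ‖h p‖ ^ 2))⁻¹ : ℝ)) * ((i.factorial * (k + i).descFactorial i : ℕ) : ℂ) *
        ((∑ p, ‖h p‖ ^ 2 : ℝ) : ℂ) := by ring
    _ = 1 := by
      rw [s1, ← s2, ← e2]
      push_cast
      have f1 : (k.factorial : ℂ) ≠ 0 := by exact_mod_cast k.factorial_ne_zero
      have f2 : (i.factorial : ℂ) ≠ 0 := by exact_mod_cast i.factorial_ne_zero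
      have f3 : ((k + i).descFactorial i : ℂ) ≠ 0 := by
        intro h
        have h' : (k + i).descFactorial i = 0 := by exact_mod_cast h
        rw [h', mul_zero] at e2
        exact (k + i).factorial_ne_zero e2.symm
      field_simp

/-- The multiplet as a matrix whose columns are the states. -/
def multipletMatrix (P : Matrix ι ι ℂ) (h : ι → ℂ) (c : ℕ) : Matrix ι (Fin (c + 1)) ℂ :=
  Matrix.of fun p k => multiplet P h c k p

theorem IsHighest.plus_mul (H : IsHighest Z P h c) :
    P * multipletMatrix P h c = multipletMatrix P h c * spinPlus c := by
  ext p k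
  have h1 := congrFun (H.plus_multiplet (Nat.lt_succ_iff.1 k.2)) p
  rw [Pi.smul_apply, smul_eq_mul, mul_comm, ← sum_mul_spinPlus (fun k => multiplet P h c k p)] at h1
  exact h1

theorem IsHighest.minus_mul (H : IsHighest Z P h c) :
    Pᴴ * multipletMatrix P h c = multipletMatrix P h c * spinMinus c := by
  ext p k
  have h1 := congrFun (H.minus_multiplet (Nat.lt_succ_iff.1 k.2)) p
  rw [Pi.smul_apply, smul_eq_mul, mul_comm, ← sum_mul_spinMinus (fun k => multiplet P h c k p)] at h1
  exact h1

theorem IsHighest.y_mul (H : IsHighest Z P h c) :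
    ((1 / (2 * Complex.I)) • (P - Pᴴ)) * multipletMatrix P h c =
      multipletMatrix P h c * spinY c := by
  rw [spinY, Matrix.smul_mul, Matrix.mul_smul, Matrix.sub_mul, Matrix.mul_sub, H.plus_mul,
    H.minus_mul]

/-- States with different `k` have different `J_z` eigenvalues; the diagonal entries are the norms.
-/
theorem IsHighest.conjTranspose_mul_self (H : IsHighest Z P h c) (h0 : h ≠ 0) :
    (multipletMatrix P h c)ᴴ * multipletMatrix P h c = 1 := by
  ext k l
  have e : ((multipletMatrix P h c)ᴴ * multipletMatrix P h c) k l =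
    star (multiplet P h c k) ⬝ᵥ multiplet P h c l := rfl
  rw [e, Matrix.one_apply]
  split_ifs with hkl
  · subst hkl
    exact H.norm_multiplet h0 (Nat.lt_succ_iff.1 k.2)
  · refine dotProduct_eq_zero_of_mulVec_eq H.isHermitian (H.z_multiplet (Nat.lt_succ_iff.1 k.2))
      (H.z_multiplet (Nat.lt_succ_iff.1 l.2)) fun h => hkl (Fin.ext ?_)
    have : (k : ℝ) = (l : ℝ) := by linarith
    exact_mod_cast this

/-- Different highest weights have different Casimir eigenvalues, since `x(x + 1)` is injective for
`x ≥ 0`. -/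
theorem IsHighest.conjTranspose_mul_of_ne {h' : ι → ℂ} {c' : ℕ} (H : IsHighest Z P h c)
    (H' : IsHighest Z P h' c') (hc : c ≠ c') :
    (multipletMatrix P h c)ᴴ * multipletMatrix P h' c' = 0 := by
  ext k l
  refine dotProduct_eq_zero_of_mulVec_eq H.casimir_isHermitian (H.casimir_multiplet k)
      (H'.casimir_multiplet l) fun h => hc ?_
  have h1 : ((c : ℝ) - c') * (c + c' + 2) = 0 := by linear_combination 4 * h
  rcases mul_eq_zero.1 h1 with h2 | h2
  · exact_mod_cast sub_eq_zero.1 h2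
  · exact absurd h2 (by positivity)

end Ladder

/-! ### The coupling of two angular momenta -/

/-- The total raising operator on the tensor product of two spins. -/
def coupledPlus (a b : ℕ) : Matrix (Fin (a + 1) × Fin (b + 1)) (Fin (a + 1) × Fin (b + 1)) ℂ :=
  spinPlus a ⊗ₖ 1 + 1 ⊗ₖ spinPlus b

/-- The total `z`-component on the tensor product of two spins. -/
def coupledZ (a b : ℕ) : Matrix (Fin (a + 1) × Fin (b + 1)) (Fin (a + 1) × Fin (b + 1)) ℂ :=
  spinZ a ⊗ₖ 1 + 1 ⊗ₖ spinZ b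

theorem coupledPlus_conjTranspose (a b : ℕ) : (coupledPlus a b)ᴴ = coupledMinus a b := by
  simp [coupledPlus, coupledMinus, Matrix.conjTranspose_add, Matrix.conjTranspose_kronecker,
    spinMinus]

theorem kronecker_mulVec_mul {ι κ : Type*} [Fintype ι] [Fintype κ] (A : Matrix ι ι ℂ)
    (B : Matrix κ κ ℂ) (x : ι → ℂ) (y : κ → ℂ) :
    (A ⊗ₖ B) *ᵥ (fun p => x p.1 * y p.2) = fun p => (A *ᵥ x) p.1 * (B *ᵥ y) p.2 := by
  ext p
  simp only [Matrix.mulVec, dotProduct, Matrix.kroneckerMap_apply, Fintype.sum_prod_type,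
    Finset.sum_mul_sum]
  refine Finset.sum_congr rfl fun i _ => Finset.sum_congr rfl fun j _ => ?_
  ring

theorem dotProduct_mul_mul {ι κ : Type*} [Fintype ι] [Fintype κ] (x x' : ι → ℂ) (y y' : κ → ℂ) :
    (fun p : ι × κ => x p.1 * y p.2) ⬝ᵥ (fun p => x' p.1 * y' p.2) =
      (x ⬝ᵥ x') * (y ⬝ᵥ y') := by
  simp only [dotProduct, Fintype.sum_prod_type, Finset.sum_mul_sum]
  refine Finset.sum_congr rfl fun i _ => Finset.sum_congr rfl fun j _ => ?_
  ring

/-- The inclusion of one slice `ι × {x}` intertwines `A ⊗ 1` with `A`, so `exp (A ⊗ 1)` can be read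
off slice by slice; likewise on the other side. The two summands commute. -/
theorem exp_kronecker_add {ι κ : Type*} [Fintype ι] [DecidableEq ι] [Fintype κ] [DecidableEq κ]
    (A : Matrix ι ι ℂ) (B : Matrix κ κ ℂ) :
    NormedSpace.exp (A ⊗ₖ (1 : Matrix κ κ ℂ) + (1 : Matrix ι ι ℂ) ⊗ₖ B) =
      NormedSpace.exp A ⊗ₖ NormedSpace.exp B := by
  have hcol (x : κ) : (A ⊗ₖ (1 : Matrix κ κ ℂ)) * (Matrix.of fun (p : ι × κ) (i : ι) =>
      if p.2 = x ∧ p.1 = i then (1 : ℂ) else 0) = (Matrix.of fun (p : ι × κ) (i : ι) =>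
      if p.2 = x ∧ p.1 = i then (1 : ℂ) else 0) * A := by
    ext ⟨i, y⟩ j
    simp [Matrix.mul_apply, Fintype.sum_prod_type, Matrix.one_apply, ite_and]
  have hcol' (x : ι) : ((1 : Matrix ι ι ℂ) ⊗ₖ B) * (Matrix.of fun (p : ι × κ) (i : κ) =>
      if p.1 = x ∧ p.2 = i then (1 : ℂ) else 0) = (Matrix.of fun (p : ι × κ) (i : κ) =>
      if p.1 = x ∧ p.2 = i then (1 : ℂ) else 0) * B := by
    ext ⟨i, y⟩ j
    simp [Matrix.mul_apply, Fintype.sum_prod_type, Matrix.one_apply, ite_and]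
  have h1 : NormedSpace.exp (A ⊗ₖ (1 : Matrix κ κ ℂ)) = NormedSpace.exp A ⊗ₖ 1 := by
    ext ⟨i, y⟩ ⟨j, z⟩
    have := congrFun (congrFun (exp_mul_of_mul_eq (hcol z)) ⟨i, y⟩) j
    simpa [Matrix.mul_apply, Fintype.sum_prod_type, Matrix.one_apply, ite_and] using this
  have h2 : NormedSpace.exp ((1 : Matrix ι ι ℂ) ⊗ₖ B) = 1 ⊗ₖ NormedSpace.exp B := by
    ext ⟨i, y⟩ ⟨j, z⟩
    have := congrFun (congrFun (exp_mul_of_mul_eq (hcol' j)) ⟨i, y⟩) z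
    simpa [Matrix.mul_apply, Fintype.sum_prod_type, Matrix.one_apply, ite_and] using this
  rw [Matrix.exp_add_of_commute, h1, h2, ← Matrix.mul_kronecker_mul, Matrix.mul_one, Matrix.one_mul]
  rw [Commute, SemiconjBy, ← Matrix.mul_kronecker_mul, ← Matrix.mul_kronecker_mul]
  simp

theorem coupledZ_comm_plus (a b : ℕ) :
    coupledZ a b * coupledPlus a b - coupledPlus a b * coupledZ a b = coupledPlus a b := by
  have ha := spinZ_mul_spinPlus a
  have hb := spinZ_mul_spinPlus b
  rw [sub_eq_iff_eq_add] at ha hb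
  simp only [coupledZ, coupledPlus, Matrix.add_mul, Matrix.mul_add, ← Matrix.mul_kronecker_mul,
    Matrix.mul_one, Matrix.one_mul, ha, hb, Matrix.add_kronecker, Matrix.kronecker_add]
  abel

theorem coupledPlus_comm_minus (a b : ℕ) :
    coupledPlus a b * (coupledPlus a b)ᴴ - (coupledPlus a b)ᴴ * coupledPlus a b =
      (2 : ℂ) • coupledZ a b := by
  have ha := spinPlus_mul_spinMinus a
  have hb := spinPlus_mul_spinMinus b
  rw [sub_eq_iff_eq_add] at ha hb
  rw [coupledPlus_conjTranspose]
  simp only [coupledZ, coupledPlus, coupledMinus, Matrix.add_mul, Matrix.mul_add,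
    ← Matrix.mul_kronecker_mul, Matrix.mul_one, Matrix.one_mul, ha, hb, Matrix.add_kronecker,
    Matrix.kronecker_add, Matrix.smul_kronecker, Matrix.kronecker_smul, smul_add]
  abel

theorem coupledPlus_mulVec_apply (a b : ℕ) (f : ℕ → ℕ → ℂ) (p : Fin (a + 1) × Fin (b + 1)) :
    (coupledPlus a b *ᵥ fun q => f q.1 q.2) p =
      f (p.1 - 1) p.2 * (Real.sqrt (((a : ℝ) - (p.1 : ℝ) + 1) * (p.1 : ℝ)) : ℝ) +
      f p.1 (p.2 - 1) * (Real.sqrt (((b : ℝ) - (p.2 : ℝ) + 1) * (p.2 : ℝ)) : ℝ) := by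
  rw [← sum_mul_spinMinus (fun k => f k p.2), ← sum_mul_spinMinus (fun k => f p.1 k),
    coupledPlus, Matrix.add_mulVec, Pi.add_apply]
  simp only [spinMinus_apply, Matrix.mulVec, dotProduct, Fintype.sum_prod_type,
    Matrix.kroneckerMap_apply]
  congr 1
  · simp [Matrix.one_apply, mul_comm]
  · rw [Finset.sum_comm]
    simp [Matrix.one_apply, mul_comm]

theorem sqrt_factorial_div_succ (k d : ℕ) (x y : ℝ) (hx : 0 ≤ x) (hy : 0 ≤ y) :
    Real.sqrt ((k.factorial * x) / (((d + 1).factorial : ℝ) * y)) * Real.sqrt (((d : ℝ) + 1) *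
      ((k : ℝ) + 1)) = Real.sqrt (((k + 1).factorial * x) / ((d.factorial : ℝ) * y)) := by
  rw [← Real.sqrt_mul (by positivity)]
  congr 1
  rw [Nat.factorial_succ, Nat.factorial_succ]
  push_cast
  rcases eq_or_ne y 0 with rfl | hy
  · simp
  field_simp

/-- Each component of the image receives two contributions, one from raising each factor. By
`sqrt_factorial_div_succ` they have equal modulus, and the alternating sign makes them cancel. -/
theorem coupledPlus_highestVector {a b c : ℕ} (h : Triangle a b c) :
    coupledPlus a b *ᵥ highestVector a b c = 0 := by
  obtain ⟨hev, h1, h2, h3⟩ := h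
  ext p
  refine (coupledPlus_mulVec_apply a b (fun k l => if 2 * (k + l) = a + b + c then
    (-1) ^ (a - k) *
      ((Real.sqrt (((k.factorial : ℝ) * (l.factorial : ℝ)) /
        (((a - k).factorial : ℝ) * ((b - l).factorial : ℝ))) : ℝ) : ℂ)
  else 0) p).trans ?_
  obtain ⟨⟨k, hk⟩, ⟨l, hl⟩⟩ := p
  simp only [Pi.zero_apply]
  rcases Nat.eq_zero_or_pos k with rfl | hk0
  · rcases Nat.eq_zero_or_pos l with rfl | hl0
    · simp
    -- On the edge only one contribution could survive; the triangle inequality puts its source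
    -- outside the support.
    · rw [if_neg (show ¬ 2 * (0 + (l - 1)) = a + b + c by omega)]
      simp
  · rcases Nat.eq_zero_or_pos l with rfl | hl0
    · rw [if_neg (show ¬ 2 * (k - 1 + 0) = a + b + c by omega)]
      simp
    · obtain ⟨k, rfl⟩ := Nat.exists_eq_add_of_le' hk0
      obtain ⟨l, rfl⟩ := Nat.exists_eq_add_of_le' hl0
      obtain ⟨d, rfl⟩ := Nat.exists_eq_add_of_le (show k + 1 ≤ a by omega)
      obtain ⟨e, rfl⟩ := Nat.exists_eq_add_of_le (show l + 1 ≤ b by omega)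
      simp only [Nat.add_sub_cancel]
      have e1 : k + 1 + d - k = d + 1 := by omega
      have e2 : l + 1 + e - l = e + 1 := by omega
      have e3 : k + 1 + d - (k + 1) = d := by omega
      have e4 : l + 1 + e - (l + 1) = e := by omega
      have e5 : ((k + 1 + d : ℕ) : ℝ) - ((k + 1 : ℕ) : ℝ) + 1 = d + 1 := by push_cast; ring
      have e6 : ((l + 1 + e : ℕ) : ℝ) - ((l + 1 : ℕ) : ℝ) + 1 = e + 1 := by push_cast; ring
      rw [e1, e2, e3, e4, e5, e6]
      by_cases hc : 2 * (k + 1 + l) = k + 1 + d + (l + 1 + e) + c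
      · rw [if_pos (by omega), if_pos (by omega)]
        have s1 := sqrt_factorial_div_succ k d (l + 1).factorial e.factorial (by positivity)
          (by positivity)
        have s2 := sqrt_factorial_div_succ l e (k + 1).factorial d.factorial (by positivity)
          (by positivity)
        rw [mul_comm (l.factorial : ℝ), mul_comm ((e + 1).factorial : ℝ),
          mul_comm ((l + 1).factorial : ℝ), mul_comm (e.factorial : ℝ), ← s1] at s2
        push_cast at s2 ⊢
        rw [mul_assoc, mul_assoc, ← Complex.ofReal_mul, ← Complex.ofReal_mul, s2]
        push_cast
        ring
      · rw [if_neg (by omega), if_neg (by omega)]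
        simp

theorem coupledZ_mulVec_apply (a b : ℕ) (f : Fin (a + 1) × Fin (b + 1) → ℂ)
    (p : Fin (a + 1) × Fin (b + 1)) :
    (coupledZ a b *ᵥ f) p = ((twoM a p.1 + twoM b p.2 : ℤ) : ℂ) / 2 * f p := by
  have : coupledZ a b = Matrix.diagonal fun p => ((twoM a p.1 + twoM b p.2 : ℤ) : ℂ) / 2 := by
    rw [coupledZ, spinZ, spinZ, ← Matrix.diagonal_one, ← Matrix.diagonal_one,
      Matrix.diagonal_kronecker_diagonal, Matrix.diagonal_kronecker_diagonal, Matrix.diagonal_add]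
    congr 1
    ext p
    push_cast
    ring
  rw [this, Matrix.mulVec_diagonal]

theorem coupledZ_isHermitian (a b : ℕ) : (coupledZ a b)ᴴ = coupledZ a b := by
  simp [coupledZ, Matrix.conjTranspose_add, Matrix.conjTranspose_kronecker, spinZ_isHermitian]

theorem isHighest_highestVector {a b c : ℕ} (h : Triangle a b c) :
    IsHighest (coupledZ a b) (coupledPlus a b) (highestVector a b c) c where
  isHermitian := coupledZ_isHermitian a b
  comm_plus := coupledZ_comm_plus a b
  comm_plus_minus := coupledPlus_comm_minus a b
  plus_mulVec := coupledPlus_highestVector h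
  z_mulVec := by
    ext p
    rw [coupledZ_mulVec_apply, Pi.smul_apply, smul_eq_mul, highestVector]
    split_ifs with hp
    · congr 2
      have : twoM a p.1 + twoM b p.2 = c := by simp only [twoM]; omega
      rw [this]
      simp
    · simp

theorem highestVector_ne_zero {a b c : ℕ} (h : Triangle a b c) : highestVector a b c ≠ 0 := by
  obtain ⟨hev, h1, h2, h3⟩ := h
  obtain ⟨r, hr⟩ := hev
  -- The component at `M₁ = J₁`; here `r = J₁ + J₂ + J`, and `r - a` is the index of `M₂ = J - J₁`.
  refine Function.ne_iff.2 ⟨(⟨a, by omega⟩, ⟨r - a, by omega⟩), ?_⟩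
  simp only [highestVector, Pi.zero_apply]
  rw [if_pos (by omega)]
  have : (0 : ℝ) < Real.sqrt ((a.factorial * (r - a).factorial) /
    ((a - a).factorial * (b - (r - a)).factorial)) := Real.sqrt_pos.2 (by positivity)
  exact mul_ne_zero (pow_ne_zero _ (by norm_num)) (by exact_mod_cast this.ne')

theorem coupledKet_eq_multiplet (a b c : ℕ) (k : Fin (c + 1)) :
    coupledKet a b c k = multiplet (coupledPlus a b) (highestVector a b c) c k := by
  rw [coupledKet, multiplet, coupledPlus_conjTranspose]

theorem triangle_sub (a b : ℕ) (i : Fin (min a b + 1)) : Triangle a b (a + b - 2 * i) := by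
  refine ⟨⟨a + b - i, ?_⟩, ?_, ?_, ?_⟩ <;> omega

/-- The dimension count behind completeness: at `t = min a b + 1` the right side equals `(a + 1)(b +
1)`. -/
theorem sum_multiplet_card {a b t : ℕ} (ht : t ≤ min a b + 1) :
    (∑ i ∈ Finset.range t, ((a + b - 2 * i + 1 : ℕ) : ℤ)) = t * (a + b + 2 - t) := by
  induction t with
  | zero => simp
  | succ t ih =>
    rw [Finset.sum_range_succ, ih (by omega), Nat.cast_add, Nat.cast_sub (by omega)]
    push_cast
    ring

/-- The states of all multiplets that occur in the coupling of two spins are complete. -/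
theorem sum_multipletMatrix_mul_conjTranspose (a b : ℕ) :
    ∑ i : Fin (min a b + 1),
      multipletMatrix (coupledPlus a b) (highestVector a b (a + b - 2 * i)) (a + b - 2 * i) *
      (multipletMatrix (coupledPlus a b) (highestVector a b (a + b - 2 * i))
        (a + b - 2 * i))ᴴ = 1 := by
  let U : Matrix (Fin (a + 1) × Fin (b + 1))
      (Σ i : Fin (min a b + 1), Fin (a + b - 2 * (i : ℕ) + 1)) ℂ :=
    Matrix.of fun p x => multipletMatrix (coupledPlus a b)
      (highestVector a b (a + b - 2 * x.1)) (a + b - 2 * x.1) p x.2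
  have h1 : Uᴴ * U = 1 := by
    ext ⟨i, k⟩ ⟨j, l⟩
    have e : (Uᴴ * U) ⟨i, k⟩ ⟨j, l⟩ =
      ((multipletMatrix (coupledPlus a b) (highestVector a b (a + b - 2 * i)) (a + b - 2 * i))ᴴ *
      multipletMatrix (coupledPlus a b) (highestVector a b (a + b - 2 * j)) (a + b - 2 * j)) k l :=
      rfl
    rw [e]
    by_cases hij : i = j
    · subst hij
      rw [(isHighest_highestVector (triangle_sub a b i)).conjTranspose_mul_self
        (highestVector_ne_zero (triangle_sub a b i)), Matrix.one_apply, Matrix.one_apply]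
      simp
    · rw [(isHighest_highestVector (triangle_sub a b i)).conjTranspose_mul_of_ne
        (isHighest_highestVector (triangle_sub a b j)), Matrix.one_apply, if_neg]
      · rfl
      · simp [hij]
      · intro h
        exact hij (Fin.ext (by omega))
  have hcard : Fintype.card (Σ i : Fin (min a b + 1), Fin (a + b - 2 * (i : ℕ) + 1)) =
      Fintype.card (Fin (a + 1) × Fin (b + 1)) := by
    simp only [Fintype.card_sigma, Fintype.card_fin, Fintype.card_prod]
    zify
    rw [Fin.sum_univ_eq_sum_range (fun i => ((a + b - 2 * i : ℕ) : ℤ) + 1)]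
    have := sum_multiplet_card (a := a) (b := b) le_rfl
    push_cast at this ⊢
    rw [this]
    rcases le_total a b with h | h
    · rw [min_eq_left (by exact_mod_cast h)]; ring
    · rw [min_eq_right (by exact_mod_cast h)]; ring
  -- An isometry between spaces of equal dimension is unitary.
  have h2 : U * Uᴴ = 1 := (Matrix.mul_eq_one_comm_of_card_eq _ _ _ hcard).1 h1
  rw [← h2]
  ext p q
  rw [Matrix.sum_apply, Matrix.mul_apply, Fintype.sum_sigma]
  rfl

/-! ### Reduced Wigner functions and the states |J M⟩ -/

/-- The reduced Wigner function `d^J_{M' M}(β) = ⟨J M'| exp(-iβJ_y) |J M⟩`, with `n = 2J`. -/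
def reducedWigner (n : ℕ) (M' M : ℤ) (β : ℝ) : ℂ :=
  star (ket n M') ⬝ᵥ (NormedSpace.exp ((-Complex.I * (β : ℂ)) • spinY n) *ᵥ ket n M)

theorem twoM_injective (n : ℕ) : Function.Injective (twoM n) := by
  intro k l h
  simp only [twoM] at h
  exact Fin.ext (by omega)

theorem star_ket (n : ℕ) (M : ℤ) : star (ket n M) = ket n M := by
  ext k
  simp only [ket, Pi.star_apply]
  split_ifs <;> simp

theorem ket_twoM (n : ℕ) (k : Fin (n + 1)) : ket n (twoM n k) = Pi.single k 1 := by
  ext l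
  simp [ket, Pi.single_apply, (twoM_injective n).eq_iff]

theorem ket_eq_zero {n : ℕ} {M : ℤ} (h : ∀ k, twoM n k ≠ M) : ket n M = 0 := by
  ext k
  simp [ket, h k]

theorem spinZ_mulVec_ket (n : ℕ) (M : ℤ) : spinZ n *ᵥ ket n M = ((M : ℂ) / 2) • ket n M := by
  ext k
  rw [spinZ, Matrix.mulVec_diagonal]
  simp only [ket, Pi.smul_apply, smul_eq_mul]
  split_ifs with h
  · rw [h]
  · simp

theorem reducedWigner_twoM (n : ℕ) (k l : Fin (n + 1)) (β : ℝ) :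
    reducedWigner n (twoM n k) (twoM n l) β =
      NormedSpace.exp ((-Complex.I * (β : ℂ)) • spinY n) k l := by
  rw [reducedWigner, star_ket, ket_twoM, ket_twoM]
  simp

theorem reducedWigner_eq_zero_left {n : ℕ} {M' : ℤ} (h : ∀ k, twoM n k ≠ M') (M : ℤ) (β : ℝ) :
    reducedWigner n M' M β = 0 := by
  simp [reducedWigner, ket_eq_zero h]

theorem reducedWigner_eq_zero_right {n : ℕ} {M : ℤ} (h : ∀ k, twoM n k ≠ M) (M' : ℤ) (β : ℝ) :
    reducedWigner n M' M β = 0 := by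
  simp [reducedWigner, ket_eq_zero h]

/-! ### Clebsch–Gordan coefficients -/

/-- The product state `|J₁ M₁⟩ |J₂ M₂⟩`. -/
def productKet (a : ℕ) (M₁ : ℤ) (b : ℕ) (M₂ : ℤ) : Fin (a + 1) × Fin (b + 1) → ℂ :=
  fun p => ket a M₁ p.1 * ket b M₂ p.2

theorem star_productKet (a : ℕ) (M₁ : ℤ) (b : ℕ) (M₂ : ℤ) :
    star (productKet a M₁ b M₂) = productKet a M₁ b M₂ := by
  ext p
  have h1 := congrFun (star_ket a M₁) p.1
  have h2 := congrFun (star_ket b M₂) p.2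
  rw [Pi.star_apply] at h1 h2 ⊢
  rw [productKet, star_mul', h1, h2]

theorem coupledZ_mulVec_productKet (a : ℕ) (M₁ : ℤ) (b : ℕ) (M₂ : ℤ) :
    coupledZ a b *ᵥ productKet a M₁ b M₂ =
      (((M₁ + M₂ : ℤ) / 2 : ℝ) : ℂ) • productKet a M₁ b M₂ := by
  ext p
  rw [coupledZ_mulVec_apply, Pi.smul_apply, smul_eq_mul, productKet]
  by_cases h1 : twoM a p.1 = M₁
  · by_cases h2 : twoM b p.2 = M₂
    · rw [h1, h2]; push_cast; rfl
    · simp [ket, h2]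
  · simp [ket, h1]

theorem star_mulVec_of_real {ι κ : Type*} [Fintype κ] {A : Matrix ι κ ℂ} {v : κ → ℂ}
    (hA : ∀ i j, star (A i j) = A i j) (hv : star v = v) : star (A *ᵥ v) = A *ᵥ v := by
  ext i
  simp only [Pi.star_apply, Matrix.mulVec, dotProduct, star_sum, star_mul']
  refine Finset.sum_congr rfl fun j _ => ?_
  rw [hA, ← Pi.star_apply, hv]

theorem star_spinPlus (n : ℕ) (k l : Fin (n + 1)) : star (spinPlus n k l) = spinPlus n k l := by
  simp only [spinPlus, Matrix.of_apply]
  split_ifs <;> simp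

theorem star_coupledMinus (a b : ℕ) (p q : Fin (a + 1) × Fin (b + 1)) :
    star (coupledMinus a b p q) = coupledMinus a b p q := by
  simp only [coupledMinus, Matrix.add_apply, Matrix.kroneckerMap_apply, star_add, star_mul',
    spinMinus_apply, star_spinPlus, Matrix.one_apply]
  congr 2 <;> split_ifs <;> simp

theorem star_highestVector (a b c : ℕ) : star (highestVector a b c) = highestVector a b c := by
  ext p
  simp only [highestVector, Pi.star_apply]
  split_ifs <;> simp

theorem star_coupledKet (a b c : ℕ) (k : Fin (c + 1)) :
    star (coupledKet a b c k) = coupledKet a b c k := by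
  have h : ∀ i : ℕ, star (coupledMinus a b ^ i *ᵥ highestVector a b c) =
      coupledMinus a b ^ i *ᵥ highestVector a b c := by
    intro i
    induction i with
    | zero => simp [star_highestVector]
    | succ i ih =>
      rw [pow_succ', ← Matrix.mulVec_mulVec]
      exact star_mulVec_of_real (star_coupledMinus a b) ih
  rw [coupledKet, star_smul, star_smul, h]
  simp

theorem clebschGordan_of_not_triangle {a b c : ℕ} (h : ¬ Triangle a b c) (M₁ M₂ M : ℤ) :
    clebschGordan a M₁ b M₂ c M = 0 := by
  rw [clebschGordan, if_neg h]

theorem clebschGordan_eq_zero {c : ℕ} {M : ℤ} (h : ∀ k, twoM c k ≠ M) (a : ℕ) (M₁ : ℤ) (b : ℕ)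
    (M₂ : ℤ) : clebschGordan a M₁ b M₂ c M = 0 := by
  rw [clebschGordan]
  split_ifs
  · exact Finset.sum_eq_zero fun k _ => by simp [ket, h k]
  · rfl

/-- Both vectors are eigenvectors of the total `J_z`, so the overlap vanishes unless the magnetic
numbers add up. -/
theorem star_productKet_dotProduct_coupledKet {a b c : ℕ} (h : Triangle a b c) (M₁ M₂ : ℤ)
    (k : Fin (c + 1)) :
    star (productKet a M₁ b M₂) ⬝ᵥ coupledKet a b c k =
      clebschGordan a M₁ b M₂ c (M₁ + M₂) * ket c (M₁ + M₂) k := by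
  by_cases hk : twoM c k = M₁ + M₂
  · rw [clebschGordan, if_pos h, ← hk, ket_twoM, Finset.sum_eq_single k]
    · simp only [Pi.single_eq_same, mul_one]
      rfl
    · intro l _ hl
      simp [hl]
    · simp
  · rw [ket, if_neg hk, mul_zero, coupledKet_eq_multiplet]
    refine dotProduct_eq_zero_of_mulVec_eq (coupledZ_isHermitian a b)
      (coupledZ_mulVec_productKet a M₁ b M₂)
      ((isHighest_highestVector h).z_multiplet (Nat.lt_succ_iff.1 k.2)) fun h' => hk ?_
    have : ((M₁ + M₂ : ℤ) : ℝ) = ((2 * (k : ℤ) - c : ℤ) : ℝ) := by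
      push_cast at h' ⊢
      linarith
    rw [twoM]
    exact_mod_cast this.symm

theorem clebschGordan_real (a : ℕ) (M₁ : ℤ) (b : ℕ) (M₂ : ℤ) (c : ℕ) (M : ℤ) :
    star (clebschGordan a M₁ b M₂ c M) = clebschGordan a M₁ b M₂ c M := by
  rw [clebschGordan]
  split_ifs
  · rw [star_sum]
    refine Finset.sum_congr rfl fun k _ => ?_
    have h1 := congrFun (star_ket c M) k
    rw [Pi.star_apply] at h1
    rw [star_mul', h1, ← Matrix.star_dotProduct_star, star_star, star_coupledKet, dotProduct_comm]
    congr 2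
    exact (star_productKet a M₁ b M₂).symm
  · simp

theorem vecMul_multipletMatrix {a b c : ℕ} (h : Triangle a b c) (M₁ M₂ : ℤ) :
    star (productKet a M₁ b M₂) ᵥ* multipletMatrix (coupledPlus a b) (highestVector a b c) c =
      clebschGordan a M₁ b M₂ c (M₁ + M₂) • ket c (M₁ + M₂) := by
  ext k
  rw [Pi.smul_apply, smul_eq_mul, ← star_productKet_dotProduct_coupledKet h,
    coupledKet_eq_multiplet]
  rfl

theorem conjTranspose_multipletMatrix_mulVec {a b c : ℕ} (h : Triangle a b c) (M₁ M₂ : ℤ) :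
    (multipletMatrix (coupledPlus a b) (highestVector a b c) c)ᴴ *ᵥ productKet a M₁ b M₂ =
      clebschGordan a M₁ b M₂ c (M₁ + M₂) • ket c (M₁ + M₂) := by
  have := congrArg star (vecMul_multipletMatrix h M₁ M₂)
  rwa [Matrix.star_vecMul, star_star, star_smul, star_ket, clebschGordan_real] at this

/-- The Clebsch–Gordan series for the reduced Wigner functions. -/
theorem reducedWigner_mul (a : ℕ) (M₁' M₁ : ℤ) (b : ℕ) (M₂' M₂ : ℤ) (β : ℝ) :
    reducedWigner a M₁' M₁ β * reducedWigner b M₂' M₂ β =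
      ∑ c ∈ Finset.range (a + b + 1), clebschGordan a M₁' b M₂' c (M₁' + M₂') *
        clebschGordan a M₁ b M₂ c (M₁ + M₂) * reducedWigner c (M₁' + M₂') (M₁ + M₂) β := by
  let t : ℂ := -Complex.I * (β : ℂ)
  -- The total `J_y` is a Kronecker sum, so its exponential is the Kronecker product of the two
  -- rotations.
  have hY : t • ((1 / (2 * Complex.I)) • (coupledPlus a b - (coupledPlus a b)ᴴ)) =
      (t • spinY a) ⊗ₖ 1 + 1 ⊗ₖ (t • spinY b) := by
    rw [coupledPlus_conjTranspose, coupledPlus, coupledMinus, spinY, spinY,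
      Matrix.smul_kronecker, Matrix.kronecker_smul, Matrix.smul_kronecker, Matrix.kronecker_smul,
      ← smul_add, ← smul_add, sub_eq_add_neg, sub_eq_add_neg, sub_eq_add_neg,
      Matrix.add_kronecker, Matrix.kronecker_add, ← neg_one_smul ℂ (spinMinus a),
      ← neg_one_smul ℂ (spinMinus b), Matrix.smul_kronecker, Matrix.kronecker_smul]
    congr 2
    module
  have hprod : reducedWigner a M₁' M₁ β * reducedWigner b M₂' M₂ β =
      star (productKet a M₁' b M₂') ⬝ᵥ
        (NormedSpace.exp (t • ((1 / (2 * Complex.I)) • (coupledPlus a b - (coupledPlus a b)ᴴ))) *ᵥ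
          productKet a M₁ b M₂) := by
    rw [hY, exp_kronecker_add, star_productKet]
    unfold productKet
    rw [kronecker_mulVec_mul, dotProduct_mul_mul, reducedWigner, reducedWigner, star_ket, star_ket]
  have hterm : ∀ i : Fin (min a b + 1), star (productKet a M₁' b M₂') ⬝ᵥ
        ((NormedSpace.exp (t • ((1 / (2 * Complex.I)) • (coupledPlus a b - (coupledPlus a b)ᴴ))) *
        (multipletMatrix (coupledPlus a b) (highestVector a b (a + b - 2 * i)) (a + b - 2 * i) *
      (multipletMatrix (coupledPlus a b) (highestVector a b (a + b - 2 * i))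
        (a + b - 2 * i))ᴴ)) *ᵥ productKet a M₁ b M₂) =
        clebschGordan a M₁' b M₂' (a + b - 2 * i) (M₁' + M₂') *
        clebschGordan a M₁ b M₂ (a + b - 2 * i) (M₁ + M₂) *
        reducedWigner (a + b - 2 * i) (M₁' + M₂') (M₁ + M₂) β := by
    intro i
    have h := triangle_sub a b i
    have hi := (isHighest_highestVector h).y_mul
    rw [← Matrix.mul_assoc, exp_mul_of_mul_eq (B := t • spinY (a + b - 2 * i)),
      ← Matrix.mulVec_mulVec, ← Matrix.mulVec_mulVec, conjTranspose_multipletMatrix_mulVec h,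
      Matrix.dotProduct_mulVec, vecMul_multipletMatrix h, Matrix.mulVec_smul, smul_dotProduct,
      dotProduct_smul, reducedWigner, star_ket, smul_eq_mul, smul_eq_mul, mul_assoc]
    rw [Matrix.smul_mul, Matrix.mul_smul, hi]
  -- The resolution of the identity is inserted to the right of the rotation; on each multiplet the
  -- rotation acts as the one of spin `c`.
  rw [hprod, ← Matrix.mul_one (NormedSpace.exp _), ← sum_multipletMatrix_mul_conjTranspose a b,
    Matrix.mul_sum, Matrix.sum_mulVec, dotProduct_sum, Finset.sum_congr rfl fun i _ => hterm i]
  have hinj : Function.Injective fun i : Fin (min a b + 1) => a + b - 2 * (i : ℕ) := by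
    intro i j h
    simp only at h
    exact Fin.ext (by omega)
  rw [← Finset.sum_image (f := fun c => clebschGordan a M₁' b M₂' c (M₁' + M₂') *
        clebschGordan a M₁ b M₂ c (M₁ + M₂) * reducedWigner c (M₁' + M₂') (M₁ + M₂) β)
        (g := fun i : Fin (min a b + 1) => a + b - 2 * (i : ℕ)) hinj.injOn]
  refine Finset.sum_subset (fun c hc => ?_) fun c _ hc => ?_
  · obtain ⟨i, -, rfl⟩ := Finset.mem_image.1 hc
    exact Finset.mem_range.2 (by omega)
  · rw [clebschGordan_of_not_triangle, zero_mul, zero_mul]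
    rintro ⟨⟨r, hr⟩, h1, h2, h3⟩
    -- With `2r = a + b + c`, solving `c = a + b - 2i` gives `i = a + b - r`.
    exact hc (Finset.mem_image.2 ⟨⟨a + b - r, by omega⟩, Finset.mem_univ _, by simp only; omega⟩)

/-! ### Symmetries of the reduced Wigner functions -/

theorem smul_spinY (n : ℕ) (β : ℝ) :
    (-Complex.I * (β : ℂ)) • spinY n = (-(β : ℂ) / 2) • (spinPlus n - spinMinus n) := by
  rw [spinY, smul_smul]
  congr 1
  field_simp

/-- `-iβJ_y` is a real matrix, so its adjoint is its transpose, and the same holds for its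
exponential. -/
theorem star_exp_spinY (n : ℕ) (β : ℝ) (k l : Fin (n + 1)) :
    star (NormedSpace.exp ((-Complex.I * (β : ℂ)) • spinY n) k l) =
      NormedSpace.exp ((-Complex.I * (β : ℂ)) • spinY n) k l := by
  have h : ((-Complex.I * (β : ℂ)) • spinY n)ᴴ = ((-Complex.I * (β : ℂ)) • spinY n)ᵀ := by
    ext k l
    rw [smul_spinY, Matrix.conjTranspose_apply, Matrix.transpose_apply, Matrix.smul_apply,
      Matrix.sub_apply, spinMinus_apply, star_smul, star_sub, star_spinPlus, star_spinPlus]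
    simp
  have h2 := congrArg NormedSpace.exp h
  rw [Matrix.exp_conjTranspose, Matrix.exp_transpose] at h2
  exact congrFun (congrFun h2 l) k

/-- The signed reversal `R` of the magnetic states, up to a phase the rotation by `π` about the
`y`-axis, exchanges `J_+` and `-J_-`. Hence it commutes with `J_y` and with its exponential. -/
theorem exp_spinY_rev (n : ℕ) (β : ℝ) (k l : Fin (n + 1)) :
    NormedSpace.exp ((-Complex.I * (β : ℂ)) • spinY n) k l = (-1) ^ (k + l : ℕ) *
      NormedSpace.exp ((-Complex.I * (β : ℂ)) • spinY n) k.rev l.rev := by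
  let R : Matrix (Fin (n + 1)) (Fin (n + 1)) ℂ :=
    Matrix.of fun k l => if l = k.rev then (-1) ^ (k : ℕ) else 0
  have hl (A : Matrix (Fin (n + 1)) (Fin (n + 1)) ℂ) (k l) :
      (R * A) k l = (-1) ^ (k : ℕ) * A k.rev l := by
    simp [R, Matrix.mul_apply]
  have hr (A : Matrix (Fin (n + 1)) (Fin (n + 1)) ℂ) (k l) :
      (A * R) k l = A k l.rev * (-1) ^ (l.rev : ℕ) := by
    rw [Matrix.mul_apply, Finset.sum_eq_single l.rev]
    · simp [R]
    · intro j _ hj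
      have : l ≠ j.rev := fun h => hj (by rw [h, Fin.rev_rev])
      simp [R, this]
    · simp
  have hP : ∀ k l : Fin (n + 1), spinPlus n k l.rev * (-1) ^ (l.rev : ℕ) =
      -((-1) ^ (k : ℕ) * spinPlus n l k.rev) := by
    intro k l
    have hk := k.2
    have hl := l.2
    simp only [spinPlus, Matrix.of_apply, Fin.val_rev]
    by_cases h : (k : ℕ) = n + 1 - (l + 1) + 1
    · rw [if_pos h, if_pos (by omega), h, pow_succ]
      rw [Nat.cast_sub (by omega), Nat.cast_sub (by omega)]
      push_cast
      rw [Nat.cast_sub (by omega)]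
      have e : ((n : ℝ) - (n + 1 - (l + 1))) * (n + 1 - (l + 1) + 1) =
        ((n : ℝ) - (n + 1 - (n + 1 - (l + 1) + 1 + 1))) *
          (n + 1 - (n + 1 - (l + 1) + 1 + 1) + 1) := by ring
      rw [e]
      ring_nf
    · rw [if_neg h, if_neg (by omega)]
      simp
  have hX : ((-Complex.I * (β : ℂ)) • spinY n) * R = R * ((-Complex.I * (β : ℂ)) • spinY n) := by
    ext k l
    have h1 := hP k l
    have h2 := hP l.rev k.rev
    rw [Fin.rev_rev, Fin.rev_rev] at h2
    have h3 : ((-1 : ℂ) ^ (k : ℕ)) * (-1) ^ (k : ℕ) = 1 := by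
      rw [← mul_pow]; simp
    have h4 : ((-1 : ℂ) ^ (l.rev : ℕ)) * (-1) ^ (l.rev : ℕ) = 1 := by
      rw [← mul_pow]; simp
    rw [hl, hr, smul_spinY, Matrix.smul_apply, Matrix.smul_apply, Matrix.sub_apply,
      Matrix.sub_apply, spinMinus_apply, spinMinus_apply, smul_eq_mul, smul_eq_mul]
    linear_combination (-(β : ℂ) / 2) * h1 + (β : ℂ) / 2 * (-1) ^ (k : ℕ) *
      (-1) ^ (l.rev : ℕ) * h2 - (β : ℂ) / 2 * (spinPlus n k.rev l * (-1) ^ (k : ℕ)) * h4 -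
      (β : ℂ) / 2 * (spinPlus n l.rev k * (-1) ^ (l.rev : ℕ)) * h3
  have h := congrFun (congrFun (exp_mul_of_mul_eq hX) k) l.rev
  rw [hl, hr, Fin.rev_rev] at h
  have h4 : ((-1 : ℂ) ^ (l : ℕ)) * (-1) ^ (l : ℕ) = 1 := by
    rw [← mul_pow]; simp
  rw [pow_add]
  linear_combination (-1) ^ (l : ℕ) * h - NormedSpace.exp ((-Complex.I * (β : ℂ)) • spinY n) k l * h4

theorem twoM_rev {n : ℕ} (k : Fin (n + 1)) : twoM n k.rev = -twoM n k := by
  have := k.2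
  simp only [twoM, Fin.val_rev]
  omega

theorem star_reducedWigner (n : ℕ) (k l : Fin (n + 1)) (β : ℝ) :
    star (reducedWigner n (twoM n k) (twoM n l) β) =
      (-1) ^ (k + l : ℕ) * reducedWigner n (-twoM n k) (-twoM n l) β := by
  rw [← twoM_rev, ← twoM_rev, reducedWigner_twoM, reducedWigner_twoM, star_exp_spinY,
    exp_spinY_rev]

/-! ### Coupling to angular momentum zero -/

theorem highestVector_zero (a : ℕ) (p : Fin (a + 1) × Fin (a + 1)) :
    highestVector a a 0 p = if p.2 = p.1.rev then (-1) ^ (a - (p.1 : ℕ)) else 0 := by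
  obtain ⟨⟨k, hk⟩, ⟨l, hl⟩⟩ := p
  simp only [highestVector, Fin.ext_iff, Fin.val_rev]
  by_cases h : l = a + 1 - (k + 1)
  · rw [if_pos (by omega), if_pos h]
    have h1 : a - k = l := by omega
    have h2 : a - l = k := by omega
    rw [h1, h2, mul_comm (l.factorial : ℝ), div_self (by positivity)]
    simp
  · rw [if_neg (by omega), if_neg h]

theorem sum_norm_highestVector_zero (a : ℕ) : ∑ p, ‖highestVector a a 0 p‖ ^ 2 = (a : ℝ) + 1 := by
  simp only [highestVector_zero, Fintype.sum_prod_type]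
  have : ∀ x y : Fin (a + 1), ‖if y = x.rev then (-1 : ℂ) ^ (a - (x : ℕ)) else 0‖ ^ 2 =
      if y = x.rev then (1 : ℝ) else 0 := by
    intro x y
    split_ifs <;> simp
  simp [this]

theorem clebschGordan_zero (a : ℕ) (k : Fin (a + 1)) :
    clebschGordan a (-twoM a k) a (twoM a k) 0 0 =
      (-1) ^ (k : ℕ) * ((Real.sqrt ((a : ℝ) + 1))⁻¹ : ℝ) := by
  have ht : Triangle a a 0 := ⟨⟨a, by omega⟩, by omega, by omega, by omega⟩
  have hk := k.2
  have h := star_productKet_dotProduct_coupledKet ht (-twoM a k) (twoM a k) 0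
  rw [neg_add_cancel, show ket 0 0 0 = 1 by simp [ket, twoM], mul_one] at h
  rw [← h, coupledKet]
  have hp : productKet a (-twoM a k) a (twoM a k) = Pi.single (k.rev, k) 1 := by
    ext ⟨i, j⟩
    rw [productKet, ← twoM_rev, ket_twoM, ket_twoM]
    simp only [Pi.single_apply, Prod.mk.injEq, ite_and]
    split_ifs <;> simp
  have e : a - (a - k) = (k : ℕ) := by omega
  rw [star_productKet, hp, sum_norm_highestVector_zero, single_dotProduct]
  simp [highestVector_zero, Fin.val_rev, e, mul_comm]

theorem clebschGordan_zero_of_ne {a b : ℕ} (h : a ≠ b) (M₁ M₂ M : ℤ) :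
    clebschGordan a M₁ b M₂ 0 M = 0 :=
  clebschGordan_of_not_triangle (fun ht => h (le_antisymm ht.2.1 ht.2.2.1)) _ _ _

/-! ### Integrals of the reduced Wigner functions -/

open scoped Matrix.Norms.Operator in
theorem continuous_exp_smul {ι : Type*} [Fintype ι] [DecidableEq ι] (A : Matrix ι ι ℂ) :
    Continuous fun β : ℝ => NormedSpace.exp ((-Complex.I * (β : ℂ)) • A) :=
  NormedSpace.exp_continuous.comp (by fun_prop)

theorem continuous_reducedWigner (n : ℕ) (M' M : ℤ) : Continuous (reducedWigner n M' M) := by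
  unfold reducedWigner
  have := continuous_exp_smul (spinY n)
  fun_prop

open scoped Matrix.Norms.Operator in
theorem hasDerivAt_exp_smul {ι : Type*} [Fintype ι] [DecidableEq ι] (A : Matrix ι ι ℂ) (β : ℝ) :
    HasDerivAt (fun β : ℝ => NormedSpace.exp ((-Complex.I * (β : ℂ)) • A))
      (((-Complex.I) • A) * NormedSpace.exp ((-Complex.I * (β : ℂ)) • A)) β := by
  have h : ∀ β : ℝ, (-Complex.I * (β : ℂ)) • A = β • ((-Complex.I) • A) := by
    intro β
    ext i j
    simp
    ring
  simp only [h]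
  exact hasDerivAt_exp_smul_const' _ _

open scoped Matrix.Norms.Operator in
theorem HasDerivAt.matrix_entry {ι : Type*} [Fintype ι] [DecidableEq ι] {F : ℝ → Matrix ι ι ℂ}
    {F' : Matrix ι ι ℂ} {t : ℝ} (h : HasDerivAt F F' t) (i j : ι) :
    HasDerivAt (fun t => F t i j) (F' i j) t :=
  (LinearMap.toContinuousLinearMap (Matrix.entryLinearMap ℝ ℂ i j)).hasFDerivAt.comp_hasDerivAt t h

/-! ### Angular momentum algebra and Legendre's equation -/

/-- `J_x = (J_+ + J_-) / 2`. -/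
def spinX (n : ℕ) : Matrix (Fin (n + 1)) (Fin (n + 1)) ℂ :=
  (1 / 2 : ℂ) • (spinPlus n + spinMinus n)

theorem spinZ_mul_spinMinus (n : ℕ) :
    spinZ n * spinMinus n = spinMinus n * spinZ n - spinMinus n := by
  have := congrArg Matrix.conjTranspose (spinZ_mul_spinPlus n)
  rw [Matrix.conjTranspose_sub, Matrix.conjTranspose_mul, Matrix.conjTranspose_mul,
    spinZ_isHermitian] at this
  exact (sub_eq_of_eq_add (eq_add_of_sub_eq' this)).symm

theorem inv_two_mul_I : 1 / (2 * Complex.I) = -(Complex.I / 2) := by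
  field_simp
  simp

theorem spinZ_mul_spinX (n : ℕ) :
    spinX n * spinZ n = spinZ n * spinX n - Complex.I • spinY n := by
  have h1 := eq_add_of_sub_eq (spinZ_mul_spinPlus n)
  have h2 := spinZ_mul_spinMinus n
  rw [spinX, spinY, Matrix.smul_mul, Matrix.mul_smul, Matrix.add_mul, Matrix.mul_add, h1, h2,
    smul_smul, show Complex.I * (1 / (2 * Complex.I)) = 1 / 2 by field_simp]
  module

theorem spinZ_mul_spinY (n : ℕ) :
    spinZ n * spinY n = spinY n * spinZ n - Complex.I • spinX n := by
  have h1 := eq_add_of_sub_eq (spinZ_mul_spinPlus n)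
  have h2 := spinZ_mul_spinMinus n
  rw [spinX, spinY, Matrix.smul_mul, Matrix.mul_smul, Matrix.sub_mul, Matrix.mul_sub, h1, h2,
    inv_two_mul_I]
  module

theorem spinX_mul_spinY (n : ℕ) :
    spinX n * spinY n = spinY n * spinX n + Complex.I • spinZ n := by
  have h : Complex.I • spinZ n = (Complex.I / 2) • ((2 : ℂ) • spinZ n) := by
    rw [smul_smul]; congr 1; ring
  rw [h, ← spinPlus_mul_spinMinus, spinX, spinY, inv_two_mul_I]
  simp only [Matrix.smul_mul, Matrix.mul_smul, Matrix.sub_mul, Matrix.mul_sub, Matrix.add_mul,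
    Matrix.mul_add]
  module

theorem spinY_mul_spinY (n : ℕ) :
    spinY n * spinY n = ((n : ℂ) / 2 * ((n : ℂ) / 2 + 1)) • 1 - spinX n * spinX n -
      spinZ n * spinZ n := by
  have h1 : spinX n * spinX n + spinY n * spinY n = spinMinus n * spinPlus n + spinZ n := by
    have h : spinZ n = (1 / 2 : ℂ) • ((2 : ℂ) • spinZ n) := by rw [smul_smul]; norm_num
    have h' : -(Complex.I / 2) * -(Complex.I / 2) = -(1 / 4) := by
      linear_combination (1 / 4) * Complex.I_mul_I
    rw [h, ← spinPlus_mul_spinMinus, spinX, spinY, inv_two_mul_I, Matrix.smul_mul, Matrix.mul_smul,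
      Matrix.smul_mul, Matrix.mul_smul, smul_smul (-(Complex.I / 2)), h']
    simp only [Matrix.sub_mul, Matrix.mul_sub, Matrix.add_mul, Matrix.mul_add]
    module
  have h2 : spinMinus n * spinPlus n + spinZ n + spinZ n * spinZ n =
      ((n : ℂ) / 2 * ((n : ℂ) / 2 + 1)) • 1 := by
    rw [spinMinus_mul_spinPlus, spinZ, Matrix.diagonal_mul_diagonal, Matrix.diagonal_add,
      Matrix.diagonal_add, ← Matrix.diagonal_one, ← Matrix.diagonal_smul]
    congr 1
    ext k
    simp only [twoM, Pi.smul_apply, smul_eq_mul]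
    push_cast
    ring
  rw [← h2, ← h1]
  abel

theorem exp_smul_mul_exp_neg_smul {ι : Type*} [Fintype ι] [DecidableEq ι] (A : Matrix ι ι ℂ)
    (c : ℂ) : NormedSpace.exp (c • A) * NormedSpace.exp (-(c • A)) = 1 := by
  rw [← Matrix.exp_add_of_commute _ _ (Commute.refl (c • A)).neg_right]
  simp

-- With `Q` the rotated axis, `Q' = i[Q, J_y]`, which is exactly what makes `E(-β) Q(β) E(β)`
-- constant; at `β = 0` it is `J_z`.
open scoped Matrix.Norms.Operator in
theorem rotate_spinZ (n : ℕ) (β : ℝ) :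
    ((Real.cos β : ℂ) • spinZ n + (Real.sin β : ℂ) • spinX n) *
      NormedSpace.exp ((-Complex.I * (β : ℂ)) • spinY n) =
      NormedSpace.exp ((-Complex.I * (β : ℂ)) • spinY n) * spinZ n := by
  let Q : ℝ → Matrix (Fin (n + 1)) (Fin (n + 1)) ℂ := fun β =>
    (Real.cos β : ℂ) • spinZ n + (Real.sin β : ℂ) • spinX n
  let E : ℝ → Matrix (Fin (n + 1)) (Fin (n + 1)) ℂ := fun β =>
    NormedSpace.exp ((-Complex.I * (β : ℂ)) • spinY n)
  have hE : ∀ β, HasDerivAt E ((-Complex.I • spinY n) * E β) β := hasDerivAt_exp_smul (spinY n)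
  have hE' : ∀ β, HasDerivAt (fun β => E (-β)) (-((-Complex.I • spinY n) * E (-β))) β := by
    intro β
    refine HasDerivAt.congr_deriv (f := fun β => E (-β))
      ((hE (-β)).scomp β (hasDerivAt_neg β)) ?_
    rw [neg_one_smul]
  have hcomm : ∀ β, spinY n * E β = E β * spinY n := fun β =>
    (exp_mul_of_mul_eq (U := spinY n) (by simp)).symm
  have hQ : ∀ β, HasDerivAt Q (-(Real.sin β : ℂ) • spinZ n + (Real.cos β : ℂ) • spinX n) β := by
    intro β
    have h1 : HasDerivAt (fun β : ℝ => (Real.cos β : ℂ)) (-(Real.sin β : ℂ)) β := by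
      simpa using (Real.hasDerivAt_cos β).ofReal_comp
    have h2 : HasDerivAt (fun β : ℝ => (Real.sin β : ℂ)) (Real.cos β : ℂ) β :=
      (Real.hasDerivAt_sin β).ofReal_comp
    exact (h1.smul_const _).add (h2.smul_const _)
  have hconst : ∀ β, HasDerivAt (fun β => E (-β) * (Q β * E β)) 0 β := by
    intro β
    refine ((hE' β).mul ((hQ β).mul (hE β))).congr_deriv ?_
    rw [Matrix.smul_mul, hcomm, Matrix.smul_mul, Pi.mul_apply]
    have key : Q β * spinY n - spinY n * Q β =
        Complex.I • ((Real.sin β : ℂ) • spinZ n - (Real.cos β : ℂ) • spinX n) := by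
      simp only [Q, Matrix.add_mul, Matrix.mul_add, Matrix.smul_mul, Matrix.mul_smul,
        spinZ_mul_spinY, spinX_mul_spinY]
      module
    have key2 : -(Real.sin β : ℂ) • spinZ n + (Real.cos β : ℂ) • spinX n =
        Complex.I • (Q β * spinY n - spinY n * Q β) := by
      rw [key, smul_smul, Complex.I_mul_I]
      module
    rw [key2]
    simp only [Matrix.smul_mul, Matrix.mul_smul, Matrix.sub_mul, Matrix.mul_sub, Matrix.mul_add,
      Matrix.mul_assoc, neg_smul, neg_neg, smul_sub, Matrix.mul_neg]
    abel
  have h := is_const_of_deriv_eq_zero (f := fun β => E (-β) * (Q β * E β))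
    (fun β => (hconst β).differentiableAt) (fun β => (hconst β).deriv) β 0
  have h0 : E 0 = 1 := by simp [E]
  have hinv : E β * E (-β) = 1 := by
    have := exp_smul_mul_exp_neg_smul (spinY n) (-Complex.I * (β : ℂ))
    simpa [E] using this
  have hQ0 : Q 0 = spinZ n := by simp [Q]
  simp only [neg_zero, h0, hQ0, Matrix.one_mul, Matrix.mul_one] at h
  change Q β * E β = E β * spinZ n
  rw [← h, ← Matrix.mul_assoc, hinv, Matrix.one_mul]

-- Legendre's equation `(sin β d')' = -J(J+1) sin β d` for `d = d^J_{00}` makes the integrand a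
-- derivative when `J ≠ 0`, and `sin β d'` vanishes at both ends. For half-odd `J` there is no state
-- with `M = 0`, and `d` is zero.
open scoped Matrix.Norms.Operator in
theorem integral_sin_mul_reducedWigner_zero (n : ℕ) :
    ∫ β in (0 : ℝ)..Real.pi, (Real.sin β : ℂ) * reducedWigner n 0 0 β =
      if n = 0 then 2 else 0 := by
  split_ifs with hn
  · subst hn
    have h1 : ∀ β, reducedWigner 0 0 0 β = 1 := by
      intro β
      have h := reducedWigner_twoM 0 0 0 β
      have hY : spinY 0 = 0 := by
        ext k l
        simp [spinY, spinMinus_apply, spinPlus]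
      rw [show twoM 0 0 = 0 by simp [twoM], hY] at h
      simpa using h
    simp only [h1, mul_one]
    rw [intervalIntegral.integral_ofReal, integral_sin]
    norm_num
  · by_cases hk : ∃ k, twoM n k = 0
    · obtain ⟨k, hk⟩ := hk
      have hd : ∀ β, reducedWigner n 0 0 β =
          NormedSpace.exp ((-Complex.I * (β : ℂ)) • spinY n) k k := by
        intro β
        rw [← reducedWigner_twoM, hk]
      simp only [hd]
      let E : ℝ → Matrix (Fin (n + 1)) (Fin (n + 1)) ℂ := fun β =>
        NormedSpace.exp ((-Complex.I * (β : ℂ)) • spinY n)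
      let A : Matrix (Fin (n + 1)) (Fin (n + 1)) ℂ := -Complex.I • spinY n
      let C : ℂ := (n : ℂ) / 2 * ((n : ℂ) / 2 + 1)
      have hC : C ≠ 0 := by
        have h1 : (n : ℂ) ≠ 0 := by exact_mod_cast hn
        have h2 : (n : ℂ) / 2 + 1 ≠ 0 := by
          have : ((n + 2 : ℕ) : ℂ) ≠ 0 := by exact Nat.cast_ne_zero.2 (by omega)
          intro h
          apply this
          push_cast
          linear_combination 2 * h
        exact mul_ne_zero (div_ne_zero h1 two_ne_zero) h2
      have hE : ∀ β, HasDerivAt E (A * E β) β := hasDerivAt_exp_smul (spinY n)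
      have hS : ∀ β, HasDerivAt (fun β : ℝ => (Real.sin β : ℂ) * (A * E β) k k)
          (-C * ((Real.sin β : ℂ) * E β k k)) β := by
        intro β
        have h2 : HasDerivAt (fun β : ℝ => (Real.sin β : ℂ)) (Real.cos β : ℂ) β :=
          (Real.hasDerivAt_sin β).ofReal_comp
        have h3 := h2.mul (((hE β).const_mul A).matrix_entry k k)
        refine h3.congr_deriv (Eq.symm ?_)
        -- The index `k` is the state `m = 0`, so in the entry `(k, k)` every term with `J_z` at
        -- either end drops out.
        have hZl : ∀ M : Matrix (Fin (n + 1)) (Fin (n + 1)) ℂ, (spinZ n * M) k k = 0 := by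
          intro M; rw [spinZ, Matrix.diagonal_mul, hk]; simp
        have hZr : ∀ M : Matrix (Fin (n + 1)) (Fin (n + 1)) ℂ, (M * spinZ n) k k = 0 := by
          intro M; rw [spinZ, Matrix.mul_diagonal, hk]; simp
        have hrot := rotate_spinZ n β
        rw [Matrix.add_mul, Matrix.smul_mul, Matrix.smul_mul] at hrot
        have hX : (Real.sin β : ℂ) • (spinX n * E β) =
            E β * spinZ n - (Real.cos β : ℂ) • (spinZ n * E β) := by
          rw [← hrot]; simp [E]
        -- Legendre's equation before taking the entry: `J_y² = J(J+1) - J_x² - J_z²`, and `hX`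
        -- trades `sin β J_x` acting on the rotation for terms with `J_z`. Commuting `J_x` past
        -- `J_z` produces the first-derivative term.
        have hAA : (Real.sin β : ℂ) • (A * (A * E β)) = -(C * (Real.sin β : ℂ)) • E β +
            (spinX n * E β) * spinZ n - (Real.cos β : ℂ) • (spinZ n * (spinX n * E β)) -
            (Real.cos β : ℂ) • (A * E β) + (Real.sin β : ℂ) • (spinZ n * (spinZ n * E β)) := by
          have h5 : (Real.sin β : ℂ) • (spinX n * (spinX n * E β)) =
              (spinX n * E β) * spinZ n - (Real.cos β : ℂ) • (spinZ n * (spinX n * E β)) -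
            (Real.cos β : ℂ) • (A * E β) := by
            rw [← Matrix.mul_smul, hX, Matrix.mul_sub, Matrix.mul_smul, ← Matrix.mul_assoc,
              ← Matrix.mul_assoc (spinX n) (spinZ n), spinZ_mul_spinX, Matrix.sub_mul]
            simp only [A, Matrix.smul_mul, Matrix.mul_assoc]
            module
          have h6 : A * (A * E β) = -((spinY n * spinY n) * E β) := by
            simp only [A, Matrix.smul_mul, Matrix.mul_smul, Matrix.mul_assoc, smul_smul]
            rw [neg_mul_neg, Complex.I_mul_I, neg_one_smul]
          rw [h6, spinY_mul_spinY, Matrix.sub_mul, Matrix.sub_mul, Matrix.smul_mul,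
            Matrix.one_mul, Matrix.mul_assoc, Matrix.mul_assoc]
          rw [neg_sub, smul_sub, smul_sub, h5]
          simp only [C]
          module
        have h7 := congrFun (congrFun hAA k) k
        simp only [Matrix.add_apply, Matrix.sub_apply, Matrix.smul_apply, smul_eq_mul, hZl, hZr]
          at h7
        rw [h7]
        ring
      have hcont : Continuous fun β : ℝ => -C * ((Real.sin β : ℂ) * E β k k) := by
        have : Continuous E := continuous_exp_smul (spinY n)
        fun_prop
      have hint := intervalIntegral.integral_eq_sub_of_hasDerivAt (fun β _ => hS β)
        (hcont.intervalIntegrable 0 Real.pi)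
      rw [intervalIntegral.integral_const_mul] at hint
      have hzero : -C * ∫ β in (0 : ℝ)..Real.pi, (Real.sin β : ℂ) * E β k k = 0 := by
        rw [hint]; simp
      exact (mul_eq_zero.1 hzero).resolve_left (neg_ne_zero.2 hC)
    · push Not at hk
      simp [reducedWigner_eq_zero_left hk]

/-- Orthogonality of the reduced Wigner functions with the same magnetic quantum numbers. -/
theorem integral_reducedWigner_mul (a b : ℕ) (k l : Fin (a + 1)) :
    ∫ β in (0 : ℝ)..Real.pi, (Real.sin β : ℂ) *
      (star (reducedWigner a (twoM a k) (twoM a l) β) * reducedWigner b (twoM a k) (twoM a l) β) =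
      if a = b then 2 / ((a : ℂ) + 1) else 0 := by
  -- Conjugation negates the magnetic numbers, so the product couples to total `M = 0` and expands
  -- in `d^c_{00}`; only `c = 0` has a nonzero integral.
  simp only [star_reducedWigner, mul_assoc, reducedWigner_mul, neg_add_cancel]
  have h1 : ∀ β : ℝ, (Real.sin β : ℂ) * ((-1) ^ (k + l : ℕ) * ∑ c ∈ Finset.range (a + b + 1),
      clebschGordan a (-twoM a k) b (twoM a k) c 0 * (clebschGordan a (-twoM a l) b (twoM a l) c 0 *
        reducedWigner c 0 0 β)) = ∑ c ∈ Finset.range (a + b + 1),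
      ((-1) ^ (k + l : ℕ) * clebschGordan a (-twoM a k) b (twoM a k) c 0 *
      clebschGordan a (-twoM a l) b (twoM a l) c 0) *
        ((Real.sin β : ℂ) * reducedWigner c 0 0 β) := by
    intro β
    rw [Finset.mul_sum, Finset.mul_sum]
    exact Finset.sum_congr rfl fun c _ => by ring
  simp only [h1]
  rw [intervalIntegral.integral_finsetSum]
  · simp only [intervalIntegral.integral_const_mul, integral_sin_mul_reducedWigner_zero]
    rw [Finset.sum_eq_single 0 (fun c _ hc => by simp [hc]) (by simp), if_pos rfl]
    split_ifs with hab
    · subst hab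
      rw [clebschGordan_zero, clebschGordan_zero]
      have h2 := ofReal_sqrt_mul_self (x := (a : ℝ) + 1) (by positivity)
      have h3 : ((-1 : ℂ) ^ (k + l : ℕ)) * ((-1) ^ (k : ℕ) * (-1) ^ (l : ℕ)) = 1 := by
        rw [← pow_add, ← mul_pow]; simp
      push_cast at h2 ⊢
      rw [← h2, div_eq_mul_inv, mul_inv]
      linear_combination 2 * (((Real.sqrt ((a : ℝ) + 1)) : ℂ)⁻¹ *
        ((Real.sqrt ((a : ℝ) + 1)) : ℂ)⁻¹) * h3
    · simp [clebschGordan_zero_of_ne hab]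
  · intro c _
    have := continuous_reducedWigner c 0 0
    exact Continuous.intervalIntegrable (by fun_prop) _ _

/-! ### Canonical anticommutation relations -/

section Anticommutation

variable {ι : Type*} [LinearOrder ι]

/-- The sign `(-1)^n`, where `n` is the number of occupied modes before `i`. -/
def fermiSign (i : ι) (T : Finset ι) : ℂ := (-1) ^ (T.filter (· < i)).card

theorem fermiSign_mul_self (i : ι) (T : Finset ι) : fermiSign i T * fermiSign i T = 1 := by
  rw [fermiSign, ← mul_pow]
  simp

theorem fermiSign_insert {i j : ι} {T : Finset ι} (hi : i ∉ T) :
    fermiSign j (insert i T) = (if i < j then -1 else 1) * fermiSign j T := by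
  rw [fermiSign, fermiSign, Finset.filter_insert]
  split_ifs
  · rw [Finset.card_insert_of_notMem (by simp [hi]), pow_succ]
    ring
  · simp

theorem fermiSign_erase {i j : ι} {T : Finset ι} (hi : i ∈ T) :
    fermiSign j (T.erase i) = (if i < j then -1 else 1) * fermiSign j T := by
  conv_rhs => rw [← Finset.insert_erase hi, fermiSign_insert (Finset.notMem_erase i T)]
  split_ifs <;> simp

/-- The vector `v` has particle number `n`. -/
def HasParticleNumber (n : ℕ) (v : Finset ι → ℂ) : Prop := ∀ T, v T ≠ 0 → T.card = n

theorem hasParticleNumber_vacuum : HasParticleNumber 0 (vacuum ι) := by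
  intro T hT
  by_contra h
  exact hT (by simp [vacuum, Finset.card_eq_zero.not.1 h])

variable [Fintype ι]

theorem create_mulVec (i : ι) (v : Finset ι → ℂ) (T : Finset ι) :
    (create i *ᵥ v) T = if i ∈ T then fermiSign i T * v (T.erase i) else 0 := by
  simp only [Matrix.mulVec, dotProduct, create, Matrix.of_apply]
  split_ifs with h
  · rw [Finset.sum_eq_single (T.erase i)]
    · have h1 := fermiSign_erase (j := i) h
      simp only [lt_irrefl, if_false, one_mul] at h1
      rw [← h1]
      simp [Finset.insert_erase h, fermiSign]
    · intro T' _ hT'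
      rw [if_neg, zero_mul]
      rintro ⟨h1, rfl⟩
      exact hT' (Finset.erase_insert h1).symm
    · simp
  · refine Finset.sum_eq_zero fun T' _ => ?_
    rw [if_neg, zero_mul]
    rintro ⟨-, rfl⟩
    exact h (Finset.mem_insert_self i T')

theorem create_conjTranspose_mulVec (i : ι) (v : Finset ι → ℂ) (T : Finset ι) :
    ((create i)ᴴ *ᵥ v) T = if i ∈ T then 0 else fermiSign i T * v (insert i T) := by
  simp only [Matrix.mulVec, dotProduct, create, Matrix.of_apply, Matrix.conjTranspose_apply]
  split_ifs with h
  · simp [h]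
  · rw [Finset.sum_eq_single (insert i T)]
    · simp [h, fermiSign]
    · intro T' _ hT'
      simp [hT']
    · simp

/-- Removing `i` flips the sign attached to `j` precisely when `i < j`, so for distinct modes
exactly one of the two orders acquires an extra sign. -/
theorem create_mul_create (i j : ι) : create i * create j = -(create j * create i) := by
  refine Matrix.mulVec_injective (funext fun v => ?_)
  ext T
  rw [Matrix.neg_mulVec, ← Matrix.mulVec_mulVec, ← Matrix.mulVec_mulVec, Pi.neg_apply]
  simp only [create_mulVec, Finset.mem_erase]
  by_cases hi : i ∈ T
  · by_cases hj : j ∈ T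
    · rcases lt_trichotomy i j with h | rfl | h
      · simp [hi, hj, h.ne, h.ne', fermiSign_erase, h, h.not_gt, Finset.erase_right_comm (a := i)]
        ring
      · simp
      · simp [hi, hj, h.ne, h.ne', fermiSign_erase, h, h.not_gt, Finset.erase_right_comm (a := i)]
        ring
    · simp [hj]
  · simp [hi]

theorem create_conjTranspose_mul_create (i j : ι) : (create i)ᴴ * create j =
    (if i = j then 1 else 0) - create j * (create i)ᴴ := by
  refine Matrix.mulVec_injective (funext fun v => ?_)
  ext T
  rw [Matrix.sub_mulVec, ← Matrix.mulVec_mulVec, ← Matrix.mulVec_mulVec, Pi.sub_apply]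
  simp only [create_mulVec, create_conjTranspose_mulVec, Finset.mem_erase, Finset.mem_insert]
  by_cases hij : i = j
  · subst hij
    by_cases hi : i ∈ T
    · simp [hi, fermiSign_erase, ← mul_assoc, fermiSign_mul_self]
    · simp [hi, fermiSign_insert, ← mul_assoc, fermiSign_mul_self]
  · by_cases hi : i ∈ T
    · simp [hi, hij]
    · by_cases hj : j ∈ T
      · rw [Finset.erase_insert_of_ne hij]
        rcases lt_or_gt_of_ne hij with h | h
        · simp [hi, hj, hij, Ne.symm hij, fermiSign_erase, fermiSign_insert, h, h.not_gt]
          ring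
        · simp [hi, hj, hij, Ne.symm hij, fermiSign_erase, fermiSign_insert, h, h.not_gt]
          ring
      · simp [hi, hj, hij, Ne.symm hij]

theorem create_conjTranspose_mulVec_vacuum (i : ι) : (create i)ᴴ *ᵥ vacuum ι = 0 := by
  ext T
  rw [create_conjTranspose_mulVec]
  simp [vacuum]

theorem HasParticleNumber.create {n : ℕ} {v : Finset ι → ℂ} (hv : HasParticleNumber n v) (i : ι) :
    HasParticleNumber (n + 1) (create i *ᵥ v) := by
  intro T hT
  rw [create_mulVec] at hT
  split_ifs at hT with h
  · rw [← hv _ (right_ne_zero_of_mul hT), Finset.card_erase_add_one h]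
  · exact absurd rfl hT

theorem HasParticleNumber.annihilate {n : ℕ} {v : Finset ι → ℂ}
    (hv : HasParticleNumber (n + 1) v) (i : ι) :
    HasParticleNumber n ((_root_.create i)ᴴ *ᵥ v) := by
  intro T hT
  rw [create_conjTranspose_mulVec] at hT
  split_ifs at hT with h
  · exact absurd rfl hT
  · have := hv _ (right_ne_zero_of_mul hT)
    rw [Finset.card_insert_of_notMem h] at this
    omega

theorem HasParticleNumber.eq_smul_vacuum {v : Finset ι → ℂ} (hv : HasParticleNumber 0 v) :
    v = (star (vacuum ι) ⬝ᵥ v) • vacuum ι := by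
  have hs : star (vacuum ι) = vacuum ι := by
    ext T
    by_cases h : T = ∅ <;> simp [vacuum, h]
  rw [hs]
  ext T
  by_cases h : T = ∅
  · subst h
    simp [vacuum]
  · by_contra h'
    refine h (Finset.card_eq_zero.1 (hv T fun h0 => h' ?_))
    simp [h0, vacuum, h]

end Anticommutation

/-! ### Second quantization -/

section Shells

variable {N : Type*} (S : Finset (Shell N))

/-- The single-particle state with magnetic index `k` in the shell `s`. -/
def mode (s : S) (k : Fin (s.1.twoJ + 1)) : Mode S := Sigma.mk s k

theorem mode_eq_iff {s : S} {k l : Fin (s.1.twoJ + 1)} : mode S s k = mode S s l ↔ k = l := by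
  constructor
  · intro h
    exact eq_of_heq (Sigma.mk.inj h).2
  · rintro rfl
    rfl

theorem mode_ne {s t : S} (h : s ≠ t) (k : Fin (s.1.twoJ + 1)) (l : Fin (t.1.twoJ + 1)) :
    mode S s k ≠ mode S t l :=
  fun h' => h (Sigma.mk.inj h').1

variable [LinearOrder (Mode S)]

theorem createIn_mul_createIn (s t : S) (k : Fin (s.1.twoJ + 1)) (l : Fin (t.1.twoJ + 1)) :
    createIn S s k * createIn S t l = -(createIn S t l * createIn S s k) :=
  create_mul_create _ _

theorem annihilateIn_mul_createIn_self (s : S) (k l : Fin (s.1.twoJ + 1)) :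
    annihilateIn S s k * createIn S s l =
      (if k = l then 1 else 0) - createIn S s l * annihilateIn S s k := by
  refine (create_conjTranspose_mul_create (mode S s k) (mode S s l)).trans ?_
  simp only [mode_eq_iff]
  rfl

theorem annihilateIn_mul_createIn_of_ne {s t : S} (h : s ≠ t) (k : Fin (s.1.twoJ + 1))
    (l : Fin (t.1.twoJ + 1)) :
    annihilateIn S s k * createIn S t l = -(createIn S t l * annihilateIn S s k) := by
  refine (create_conjTranspose_mul_create (mode S s k) (mode S t l)).trans ?_
  rw [if_neg (mode_ne S h k l), zero_sub]
  rfl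

/-- Commuting `a†_l a_k` with `a†_x` leaves `a†_l {a_k, a†_x}`, and the anticommutator is zero
unless `k` and `x` are the same mode. -/
theorem secondQuantized_mul_createIn (A : (n : ℕ) → Matrix (Fin (n + 1)) (Fin (n + 1)) ℂ) (s : S)
    (x : Fin (s.1.twoJ + 1)) :
    secondQuantized S A * createIn S s x = createIn S s x * secondQuantized S A +
      ∑ l, A s.1.twoJ l x • createIn S s l := by
  have h1 : ∀ (t : S) (l k : Fin (t.1.twoJ + 1)),
      createIn S t l * annihilateIn S t k * createIn S s x =
      createIn S s x * (createIn S t l * annihilateIn S t k) +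
        createIn S t l * (annihilateIn S t k * createIn S s x +
          createIn S s x * annihilateIn S t k) := by
    intro t l k
    rw [Matrix.mul_add, ← Matrix.mul_assoc (createIn S t l) (createIn S s x),
      createIn_mul_createIn S t s, Matrix.mul_assoc, Matrix.neg_mul, Matrix.mul_assoc]
    abel
  simp only [secondQuantized, Matrix.sum_mul, Matrix.mul_sum, Matrix.smul_mul, h1, smul_add,
    Finset.sum_add_distrib, Matrix.mul_smul]
  congr 1
  rw [Finset.sum_eq_single s]
  · refine Finset.sum_congr rfl fun l _ => ?_
    rw [Finset.sum_eq_single x]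
    · rw [annihilateIn_mul_createIn_self]
      simp
    · intro k _ hk
      rw [annihilateIn_mul_createIn_self]
      simp [hk]
    · simp
  · intro t _ ht
    refine Finset.sum_eq_zero fun l _ => Finset.sum_eq_zero fun k _ => ?_
    rw [annihilateIn_mul_createIn_of_ne S ht]
    simp
  · simp

theorem secondQuantized_mulVec_vacuum (A : (n : ℕ) → Matrix (Fin (n + 1)) (Fin (n + 1)) ℂ) :
    secondQuantized S A *ᵥ vacuum (Mode S) = 0 := by
  have h : ∀ (s : S) (k : Fin (s.1.twoJ + 1)), annihilateIn S s k *ᵥ vacuum (Mode S) = 0 :=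
    fun s k => create_conjTranspose_mulVec_vacuum _
  simp [secondQuantized, Matrix.sum_mulVec, Matrix.smul_mulVec, ← Matrix.mulVec_mulVec, h]

theorem secondQuantized_isHermitian {A : (n : ℕ) → Matrix (Fin (n + 1)) (Fin (n + 1)) ℂ}
    (hA : ∀ n, (A n)ᴴ = A n) : (secondQuantized S A)ᴴ = secondQuantized S A := by
  simp only [secondQuantized, Matrix.conjTranspose_sum, Matrix.conjTranspose_smul,
    Matrix.conjTranspose_mul, annihilateIn, Matrix.conjTranspose_conjTranspose]
  refine Finset.sum_congr rfl fun s _ => ?_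
  rw [Finset.sum_comm]
  refine Finset.sum_congr rfl fun l _ => Finset.sum_congr rfl fun k _ => ?_
  rw [← Matrix.conjTranspose_apply, hA]

/-- The exponentiated commutation relation: a rotation carries a creation operator to a combination
of those of the same shell. The row `W` of all creation operators of the shell intertwines the
generator with a Kronecker sum, whose exponential factorizes. -/
theorem exp_secondQuantized_mul_createIn (A : (n : ℕ) → Matrix (Fin (n + 1)) (Fin (n + 1)) ℂ)
    (c : ℂ) (s : S) (x : Fin (s.1.twoJ + 1)) :
    NormedSpace.exp (c • secondQuantized S A) * createIn S s x =
      ∑ l, NormedSpace.exp (c • A s.1.twoJ) l x •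
        (createIn S s l * NormedSpace.exp (c • secondQuantized S A)) := by
  let W : Matrix (Finset (Mode S)) (Finset (Mode S) × Fin (s.1.twoJ + 1)) ℂ :=
    Matrix.of fun T q => createIn S s q.2 T q.1
  have hW (B : Matrix (Finset (Mode S)) (Finset (Mode S)) ℂ) (T T' y) :
      (B * W) T (T', y) = (B * createIn S s y) T T' := rfl
  have hW' (B : Matrix (Finset (Mode S)) (Finset (Mode S)) ℂ)
      (X : Matrix (Fin (s.1.twoJ + 1)) (Fin (s.1.twoJ + 1)) ℂ) (T T' y) :
      (W * (B ⊗ₖ X)) T (T', y) = ∑ l, X l y * (createIn S s l * B) T T' := by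
    simp only [W, Matrix.mul_apply, Matrix.of_apply, Matrix.kroneckerMap_apply,
      Fintype.sum_prod_type, Finset.mul_sum]
    rw [Finset.sum_comm]
    refine Finset.sum_congr rfl fun l _ => Finset.sum_congr rfl fun U _ => ?_
    ring
  have h : (c • secondQuantized S A) * W = W * ((c • secondQuantized S A) ⊗ₖ 1 +
      1 ⊗ₖ (c • A s.1.twoJ)) := by
    ext T ⟨T', y⟩
    rw [hW, Matrix.mul_add, Matrix.add_apply, hW', hW', Matrix.smul_mul,
      secondQuantized_mul_createIn]
    simp only [Matrix.one_apply, ite_mul, one_mul, zero_mul, Finset.sum_ite_eq',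
      Finset.mem_univ, if_true, Matrix.mul_one, Matrix.smul_apply, Matrix.add_apply,
      Matrix.sum_apply, smul_eq_mul, mul_add, Finset.mul_sum, Matrix.mul_smul, mul_assoc]
  have h2 := exp_mul_of_mul_eq h
  rw [exp_kronecker_add] at h2
  ext T T'
  rw [← hW, h2, hW', Matrix.sum_apply]
  rfl

/-! ### Products of creation operators in a shell -/

variable {S}

theorem creator_zero (s : S) (m : Fin 0 → Fin (s.1.twoJ + 1)) : creator S s m = 1 := by
  simp [creator]

theorem creator_succ (s : S) {p : ℕ} (m : Fin (p + 1) → Fin (s.1.twoJ + 1)) :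
    creator S s m = createIn S s (m 0) * creator S s (fun i => m i.succ) := by
  simp [creator, List.ofFn_succ]

theorem exp_secondQuantized_mul_creator (A : (n : ℕ) → Matrix (Fin (n + 1)) (Fin (n + 1)) ℂ)
    (c : ℂ) (s : S) {p : ℕ} (m : Fin p → Fin (s.1.twoJ + 1)) :
    NormedSpace.exp (c • secondQuantized S A) * creator S s m =
      ∑ L : Fin p → Fin (s.1.twoJ + 1), (∏ i, NormedSpace.exp (c • A s.1.twoJ) (L i) (m i)) •
        (creator S s L * NormedSpace.exp (c • secondQuantized S A)) := by
  induction p with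
  | zero => simp [creator_zero]
  | succ p ih =>
    rw [← (Fin.consEquiv fun _ => Fin (s.1.twoJ + 1)).sum_comp, Fintype.sum_prod_type,
      creator_succ, ← Matrix.mul_assoc, exp_secondQuantized_mul_createIn, Matrix.sum_mul]
    refine Finset.sum_congr rfl fun l _ => ?_
    rw [Matrix.smul_mul, Matrix.mul_assoc, ih, Matrix.mul_sum, Finset.smul_sum]
    refine Finset.sum_congr rfl fun L _ => ?_
    rw [Matrix.mul_smul, smul_smul, Fin.prod_univ_succ, creator_succ, Matrix.mul_assoc]
    rfl

theorem secondQuantized_spinZ_mul_creator (s : S) {p : ℕ} (m : Fin p → Fin (s.1.twoJ + 1)) :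
    secondQuantized S spinZ * creator S s m = creator S s m * secondQuantized S spinZ +
      ((totalTwoM m : ℂ) / 2) • creator S s m := by
  induction p with
  | zero => simp [creator_zero, totalTwoM]
  | succ p ih =>
    have h1 : ∑ l, spinZ s.1.twoJ l (m 0) • createIn S s l =
        ((twoM s.1.twoJ (m 0) : ℂ) / 2) • createIn S s (m 0) := by
      rw [Finset.sum_eq_single (m 0)]
      · rw [spinZ, Matrix.diagonal_apply_eq]
      · intro l _ hl
        rw [spinZ, Matrix.diagonal_apply_ne _ hl, zero_smul]
      · simp
    have h2 : totalTwoM m = twoM s.1.twoJ (m 0) + totalTwoM fun i => m i.succ := by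
      simp [totalTwoM, Fin.sum_univ_succ]
    rw [creator_succ, ← Matrix.mul_assoc, secondQuantized_mul_createIn, h1, Matrix.add_mul,
      Matrix.mul_assoc, ih, Matrix.mul_add, Matrix.smul_mul, Matrix.mul_smul, h2,
      ← Matrix.mul_assoc]
    push_cast
    module

theorem HasParticleNumber.creator {n : ℕ} {v : Finset (Mode S) → ℂ} (hv : HasParticleNumber n v)
    (s : S) {p : ℕ} (m : Fin p → Fin (s.1.twoJ + 1)) :
    HasParticleNumber (n + p) (creator S s m *ᵥ v) := by
  induction p with
  | zero => simpa [creator_zero] using hv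
  | succ p ih =>
    rw [creator_succ, ← Matrix.mulVec_mulVec]
    exact (ih _).create _

theorem HasParticleNumber.creator_conjTranspose {n : ℕ} {v : Finset (Mode S) → ℂ} (s : S) {p : ℕ}
    (hv : HasParticleNumber (n + p) v) (m : Fin p → Fin (s.1.twoJ + 1)) :
    HasParticleNumber n ((_root_.creator S s m)ᴴ *ᵥ v) := by
  induction p generalizing v with
  | zero => simpa [creator_zero] using hv
  | succ p ih =>
    rw [creator_succ, Matrix.conjTranspose_mul, ← Matrix.mulVec_mulVec]
    exact ih (HasParticleNumber.annihilate (n := n + p) hv _) _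

theorem creator_mul_createIn (s t : S) {p : ℕ} (m : Fin p → Fin (s.1.twoJ + 1))
    (l : Fin (t.1.twoJ + 1)) :
    creator S s m * createIn S t l = (-1 : ℂ) ^ p • (createIn S t l * creator S s m) := by
  induction p with
  | zero => simp [creator_zero]
  | succ p ih =>
    rw [creator_succ, Matrix.mul_assoc, ih, Matrix.mul_smul, ← Matrix.mul_assoc,
      createIn_mul_createIn S s t, Matrix.neg_mul, Matrix.mul_assoc, pow_succ, mul_neg_one,
      neg_smul, smul_neg]

theorem creator_conjTranspose_mul_createIn {s t : S} (h : s ≠ t) {p : ℕ}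
    (m : Fin p → Fin (s.1.twoJ + 1)) (l : Fin (t.1.twoJ + 1)) :
    (creator S s m)ᴴ * createIn S t l = (-1 : ℂ) ^ p • (createIn S t l * (creator S s m)ᴴ) := by
  induction p with
  | zero => simp [creator_zero]
  | succ p ih =>
    have h1 : (createIn S s (m 0))ᴴ * createIn S t l = -(createIn S t l * (createIn S s (m 0))ᴴ) :=
      annihilateIn_mul_createIn_of_ne S h (m 0) l
    rw [creator_succ, Matrix.conjTranspose_mul, Matrix.mul_assoc, h1, Matrix.mul_neg,
      ← Matrix.mul_assoc, ih, Matrix.smul_mul, Matrix.mul_assoc, pow_succ, mul_neg_one, neg_smul]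

/-- An operator of another shell passes `p` creators and then `p` annihilators; the two signs
`(-1)^p` cancel. -/
theorem creator_conjTranspose_mul_creator_commute {s t : S} (h : s ≠ t) {p q : ℕ}
    (m m' : Fin p → Fin (s.1.twoJ + 1)) (l : Fin q → Fin (t.1.twoJ + 1)) :
    Commute ((creator S s m')ᴴ * creator S s m) (creator S t l) := by
  refine Commute.list_prod_right _ _ fun x hx => ?_
  obtain ⟨i, rfl⟩ := (List.mem_ofFn' _ _).1 hx
  rw [Commute, SemiconjBy, mul_assoc, creator_mul_createIn, Matrix.mul_smul, ← mul_assoc,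
    creator_conjTranspose_mul_createIn h, Matrix.smul_mul, smul_smul, ← mul_pow, mul_assoc]
  simp

/-! ### Overlaps and matrix elements of shell states -/

theorem star_stateOf_dotProduct (A B : Matrix (Finset (Mode S)) (Finset (Mode S)) ℂ) :
    star (stateOf S A) ⬝ᵥ stateOf S B =
      star (vacuum (Mode S)) ⬝ᵥ ((Aᴴ * B) *ᵥ vacuum (Mode S)) := by
  rw [stateOf, stateOf, Matrix.star_mulVec, ← Matrix.dotProduct_mulVec, Matrix.mulVec_mulVec]

/-- The first-shell pair of equal particle number commutes through to the vacuum. The result has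
particle number zero, so it is the overlap times the vacuum. -/
theorem star_stateOf_mul_dotProduct {s t : S} (h : s ≠ t) {p q : ℕ}
    (m m' : Fin p → Fin (s.1.twoJ + 1)) (l l' : Fin q → Fin (t.1.twoJ + 1)) :
    star (stateOf S (creator S s m' * creator S t l')) ⬝ᵥ
      stateOf S (creator S s m * creator S t l) =
      (star (stateOf S (creator S s m')) ⬝ᵥ stateOf S (creator S s m)) *
      (star (stateOf S (creator S t l')) ⬝ᵥ stateOf S (creator S t l)) := by
  rw [star_stateOf_dotProduct, star_stateOf_dotProduct (creator S s m'),
    star_stateOf_dotProduct (creator S t l')]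
  have hc := (creator_conjTranspose_mul_creator_commute h m m' l).eq
  have hv : HasParticleNumber 0 (((creator S s m')ᴴ * creator S s m) *ᵥ vacuum (Mode S)) := by
    rw [← Matrix.mulVec_mulVec]
    exact HasParticleNumber.creator_conjTranspose s (hasParticleNumber_vacuum.creator s m) m'
  have e : (creator S s m' * creator S t l')ᴴ * (creator S s m * creator S t l) =
      ((creator S t l')ᴴ * creator S t l) * ((creator S s m')ᴴ * creator S s m) := by
    rw [Matrix.mul_assoc _ (creator S t l), ← hc, Matrix.conjTranspose_mul]
    simp only [Matrix.mul_assoc]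
  rw [e, ← Matrix.mulVec_mulVec, hv.eq_smul_vacuum, Matrix.mulVec_smul, dotProduct_smul,
    smul_eq_mul, ← hv.eq_smul_vacuum]

theorem exp_secondQuantized_mulVec_vacuum
    (A : (n : ℕ) → Matrix (Fin (n + 1)) (Fin (n + 1)) ℂ) (c : ℂ) :
    NormedSpace.exp (c • secondQuantized S A) *ᵥ vacuum (Mode S) = vacuum (Mode S) := by
  have := exp_smul_mulVec_of_mulVec_eq (μ := 0)
    ((secondQuantized_mulVec_vacuum S A).trans (zero_smul ℂ (vacuum (Mode S))).symm) c
  simpa using this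

/-- The matrix elements of a second-quantized one-body transformation in a single shell. -/
theorem matrixElement_exp_secondQuantized
    (A : (n : ℕ) → Matrix (Fin (n + 1)) (Fin (n + 1)) ℂ) (c : ℂ) (s : S) {p : ℕ}
    (m m' : Fin p → Fin (s.1.twoJ + 1)) :
    matrixElement (stateOf S (creator S s m')) (NormedSpace.exp (c • secondQuantized S A))
      (stateOf S (creator S s m)) =
      ∑ L : Fin p → Fin (s.1.twoJ + 1), (∏ i, NormedSpace.exp (c • A s.1.twoJ) (L i) (m i)) *
        (star (stateOf S (creator S s m')) ⬝ᵥ stateOf S (creator S s L)) := by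
  rw [matrixElement, stateOf, stateOf, Matrix.mulVec_mulVec, exp_secondQuantized_mul_creator,
    Matrix.sum_mulVec, dotProduct_sum]
  refine Finset.sum_congr rfl fun L _ => ?_
  rw [Matrix.smul_mulVec, ← Matrix.mulVec_mulVec, exp_secondQuantized_mulVec_vacuum,
    dotProduct_smul, smul_eq_mul, stateOf]

/-- The matrix elements of a second-quantized one-body transformation factorize over shells. -/
theorem matrixElement_exp_secondQuantized_mul
    (A : (n : ℕ) → Matrix (Fin (n + 1)) (Fin (n + 1)) ℂ) (c : ℂ) {s t : S} (h : s ≠ t) {p q : ℕ}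
    (m m' : Fin p → Fin (s.1.twoJ + 1)) (l l' : Fin q → Fin (t.1.twoJ + 1)) :
    matrixElement (stateOf S (creator S s m' * creator S t l'))
      (NormedSpace.exp (c • secondQuantized S A)) (stateOf S (creator S s m * creator S t l)) =
      matrixElement (stateOf S (creator S s m')) (NormedSpace.exp (c • secondQuantized S A))
        (stateOf S (creator S s m)) *
      matrixElement (stateOf S (creator S t l')) (NormedSpace.exp (c • secondQuantized S A))
        (stateOf S (creator S t l)) := by
  rw [matrixElement_exp_secondQuantized, matrixElement_exp_secondQuantized, Finset.sum_mul_sum,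
    matrixElement, stateOf.eq_def S (creator S s m * _), Matrix.mulVec_mulVec, ← Matrix.mul_assoc,
    exp_secondQuantized_mul_creator, Matrix.sum_mul, Matrix.sum_mulVec, dotProduct_sum]
  refine Finset.sum_congr rfl fun L _ => ?_
  rw [Matrix.smul_mul, Matrix.mul_assoc, exp_secondQuantized_mul_creator, Matrix.mul_sum,
    Finset.smul_sum, Matrix.sum_mulVec, dotProduct_sum]
  refine Finset.sum_congr rfl fun L' _ => ?_
  rw [Matrix.mul_smul, smul_smul, Matrix.smul_mulVec, ← Matrix.mul_assoc, ← Matrix.mulVec_mulVec,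
    exp_secondQuantized_mulVec_vacuum, dotProduct_smul, smul_eq_mul]
  have := star_stateOf_mul_dotProduct h L m' L' l'
  rw [stateOf.eq_def S (creator S s L * _)] at this
  rw [this]
  ring

theorem secondQuantized_spinZ_mulVec_stateOf (s : S) {p : ℕ} (m : Fin p → Fin (s.1.twoJ + 1)) :
    secondQuantized S spinZ *ᵥ stateOf S (creator S s m) =
      (((totalTwoM m : ℝ) / 2 : ℝ) : ℂ) • stateOf S (creator S s m) := by
  rw [stateOf, Matrix.mulVec_mulVec, secondQuantized_spinZ_mul_creator, Matrix.add_mulVec,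
    ← Matrix.mulVec_mulVec, secondQuantized_mulVec_vacuum, Matrix.smul_mulVec]
  simp

theorem secondQuantized_spinZ_mulVec_stateOf_mul (s t : S) {p q : ℕ}
    (m : Fin p → Fin (s.1.twoJ + 1)) (l : Fin q → Fin (t.1.twoJ + 1)) :
    secondQuantized S spinZ *ᵥ stateOf S (creator S s m * creator S t l) =
      (((totalTwoM m + totalTwoM l : ℤ) / 2 : ℝ) : ℂ) •
        stateOf S (creator S s m * creator S t l) := by
  rw [stateOf, Matrix.mulVec_mulVec, ← Matrix.mul_assoc, secondQuantized_spinZ_mul_creator,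
    Matrix.add_mul, Matrix.mul_assoc, secondQuantized_spinZ_mul_creator, Matrix.mul_add,
    Matrix.add_mulVec, Matrix.add_mulVec, ← Matrix.mul_assoc,
    ← Matrix.mulVec_mulVec _ _ (secondQuantized S spinZ), secondQuantized_mulVec_vacuum,
    Matrix.smul_mul, Matrix.mul_smul, Matrix.smul_mulVec, Matrix.smul_mulVec, Matrix.mulVec_zero,
    zero_add, ← add_smul]
  congr 1
  push_cast
  ring

theorem star_stateOf_creator_dotProduct_of_ne (s : S) {p p' : ℕ}
    {m : Fin p → Fin (s.1.twoJ + 1)} {m' : Fin p' → Fin (s.1.twoJ + 1)}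
    (h : totalTwoM m' ≠ totalTwoM m) :
    star (stateOf S (creator S s m')) ⬝ᵥ stateOf S (creator S s m) = 0 := by
  refine dotProduct_eq_zero_of_mulVec_eq (secondQuantized_isHermitian S spinZ_isHermitian)
    (secondQuantized_spinZ_mulVec_stateOf s m') (secondQuantized_spinZ_mulVec_stateOf s m)
    fun h' => h ?_
  have : (totalTwoM m' : ℝ) = totalTwoM m := by linarith
  exact_mod_cast this

end Shells

/-! ### Reduction of the projection operator to an integral over `β` -/

theorem dotProduct_eulerRotation_mulVec {ι : Type*} [Fintype ι] [DecidableEq ι]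
    {Z : Matrix ι ι ℂ} (hZ : Zᴴ = Z) (Y : Matrix ι ι ℂ) {v w : ι → ℂ} {μ ν : ℝ}
    (hv : Z *ᵥ v = (μ : ℂ) • v) (hw : Z *ᵥ w = (ν : ℂ) • w) (α β γ : ℝ) :
    star v ⬝ᵥ (eulerRotation Z Y α β γ *ᵥ w) =
      Complex.exp (-Complex.I * α * μ) * Complex.exp (-Complex.I * γ * ν) *
        (star v ⬝ᵥ (NormedSpace.exp ((-Complex.I * (β : ℂ)) • Y) *ᵥ w)) := by
  rw [eulerRotation, ← Matrix.mulVec_mulVec, ← Matrix.mulVec_mulVec,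
    exp_smul_mulVec_of_mulVec_eq hw, dotProduct_exp_mulVec_of_mulVec_eq hZ hv, Matrix.mulVec_smul,
    dotProduct_smul, smul_eq_mul]
  ring

theorem wignerD_eq (n : ℕ) (M' M : ℤ) (α β γ : ℝ) :
    wignerD n M' M α β γ = Complex.exp (-Complex.I * α * ((M' / 2 : ℝ) : ℂ)) *
      Complex.exp (-Complex.I * γ * ((M / 2 : ℝ) : ℂ)) * reducedWigner n M' M β := by
  refine dotProduct_eulerRotation_mulVec (spinZ_isHermitian n) _ ?_ ?_ α β γ
  · rw [spinZ_mulVec_ket]; push_cast; rfl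
  · rw [spinZ_mulVec_ket]; push_cast; rfl

theorem star_exp_mul_exp (x y : ℝ) :
    star (Complex.exp (-Complex.I * x * (y : ℂ))) * Complex.exp (-Complex.I * x * (y : ℂ)) = 1 := by
  rw [RCLike.star_def, ← Complex.exp_conj, ← Complex.exp_add]
  simp

theorem continuous_eulerRotation {ι : Type*} [Fintype ι] [DecidableEq ι] (Z Y : Matrix ι ι ℂ) :
    Continuous fun x : ℝ × ℝ × ℝ => eulerRotation Z Y x.1 x.2.1 x.2.2 := by
  unfold eulerRotation
  exact (((continuous_exp_smul Z).comp continuous_fst).matrix_mul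
    ((continuous_exp_smul Y).comp (continuous_fst.comp continuous_snd))).matrix_mul
    ((continuous_exp_smul Z).comp (continuous_snd.comp continuous_snd))

theorem integral_sum_mul {κ : Type*} (s : Finset κ) (w : κ → ℂ) (F : κ → ℝ → ℂ)
    (hF : ∀ i, Continuous (F i)) (a b : ℝ) :
    ∫ x in a..b, ∑ i ∈ s, w i * F i x = ∑ i ∈ s, w i * ∫ x in a..b, F i x := by
  rw [intervalIntegral.integral_finsetSum fun i _ =>
    ((hF i).const_mul (w i)).intervalIntegrable a b]
  simp only [intervalIntegral.integral_const_mul]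

/-- Additivity at each level needs integrability of the inner integrals, which comes from their
continuity in the outer variables. -/
theorem integral_integral_integral_sum_mul {κ : Type*} (s : Finset κ) (w : κ → ℂ)
    (F : κ → ℝ → ℝ → ℝ → ℂ) (hF : ∀ i, Continuous fun x : ℝ × ℝ × ℝ => F i x.1 x.2.1 x.2.2)
    (a₁ b₁ a₂ b₂ a₃ b₃ : ℝ) :
    ∫ x in a₁..b₁, ∫ y in a₂..b₂, ∫ z in a₃..b₃, ∑ i ∈ s, w i * F i x y z =
      ∑ i ∈ s, w i * ∫ x in a₁..b₁, ∫ y in a₂..b₂, ∫ z in a₃..b₃, F i x y z := by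
  have h3 : ∀ i x y, Continuous fun z => F i x y z := fun i x y =>
    (hF i).comp (by fun_prop : Continuous fun z : ℝ => ((x, y, z) : ℝ × ℝ × ℝ))
  have h2 : ∀ i, Continuous fun p : ℝ × ℝ => ∫ z in a₃..b₃, F i p.1 p.2 z := by
    intro i
    refine intervalIntegral.continuous_parametric_intervalIntegral_of_continuous' ?_ a₃ b₃
    exact (hF i).comp
      (by fun_prop : Continuous fun q : (ℝ × ℝ) × ℝ => ((q.1.1, q.1.2, q.2) : ℝ × ℝ × ℝ))
  have h1 : ∀ i, Continuous fun x => ∫ y in a₂..b₂, ∫ z in a₃..b₃, F i x y z := fun i =>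
    intervalIntegral.continuous_parametric_intervalIntegral_of_continuous' (h2 i) a₂ b₂
  have h2' : ∀ i x, Continuous fun y => ∫ z in a₃..b₃, F i x y z := fun i x =>
    (h2 i).comp (by fun_prop : Continuous fun y : ℝ => ((x, y) : ℝ × ℝ))
  simp only [integral_sum_mul s w _ (h3 · _ _), integral_sum_mul s w _ (h2' · _),
    integral_sum_mul s w _ h1]

/-- The coefficient `(2J + 1) / 2 ∫ sin β d^J_{M' M}(β)^* f(β) dβ` of `d^J_{M' M}` in `f`, with
`n = 2J`. -/
def wignerCoeff (n : ℕ) (M' M : ℤ) (f : ℝ → ℂ) : ℂ :=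
  ((n : ℂ) + 1) / 2 * ∫ β in (0 : ℝ)..Real.pi,
    (Real.sin β : ℂ) * (star (reducedWigner n M' M β) * f β)

/-- The phases in `α` and `γ` cancel pointwise because projector and states carry the same magnetic
numbers, so the range `2π` also suffices for half-odd values. The two trivial integrals give `4π²`,
turning `1/(8π²)` into `1/2`. -/
theorem matrixElement_projection {N : Type*} (S : Finset (Shell N)) [LinearOrder (Mode S)] (n : ℕ)
    {M' M : ℤ} {ψ φ : Finset (Mode S) → ℂ}
    (hψ : secondQuantized S spinZ *ᵥ ψ = ((M' / 2 : ℝ) : ℂ) • ψ)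
    (hφ : secondQuantized S spinZ *ᵥ φ = ((M / 2 : ℝ) : ℂ) • φ) :
    matrixElement ψ (projection S n M' M) φ = wignerCoeff n M' M fun β =>
      matrixElement ψ (NormedSpace.exp ((-Complex.I * (β : ℂ)) • secondQuantized S spinY)) φ := by
  have hexp : ∀ A : Matrix (Finset (Mode S)) (Finset (Mode S)) ℂ, matrixElement ψ A φ =
      ∑ x : Finset (Mode S) × Finset (Mode S), (star (ψ x.1) * φ x.2) * A x.1 x.2 := by
    intro A
    simp only [matrixElement, dotProduct, Matrix.mulVec, Fintype.sum_prod_type, Finset.mul_sum,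
      Pi.star_apply]
    exact Finset.sum_congr rfl fun _ _ => Finset.sum_congr rfl fun _ _ => by ring
  have hcont : ∀ x : Finset (Mode S) × Finset (Mode S), Continuous fun t : ℝ × ℝ × ℝ =>
      (Real.sin t.2.1 : ℂ) * star (wignerD n M' M t.1 t.2.1 t.2.2) *
        fockRotation S t.1 t.2.1 t.2.2 x.1 x.2 := by
    intro x
    have h1 : Continuous fun t : ℝ × ℝ × ℝ => fockRotation S t.1 t.2.1 t.2.2 :=
      continuous_eulerRotation _ _
    have h2 : Continuous fun t : ℝ × ℝ × ℝ => wignerD n M' M t.1 t.2.1 t.2.2 :=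
      continuous_const.dotProduct
        ((continuous_eulerRotation (spinZ n) (spinY n)).matrix_mulVec continuous_const)
    have h3 := h1.matrix_elem x.1 x.2
    fun_prop
  have hint := integral_integral_integral_sum_mul (Finset.univ)
    (fun x : Finset (Mode S) × Finset (Mode S) => star (ψ x.1) * φ x.2)
    (fun x α β γ => (Real.sin β : ℂ) * star (wignerD n M' M α β γ) *
        fockRotation S α β γ x.1 x.2) hcont 0 (2 * Real.pi) 0 Real.pi 0 (2 * Real.pi)
  have hpoint : ∀ α β γ : ℝ, ∑ x : Finset (Mode S) × Finset (Mode S),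
      (star (ψ x.1) * φ x.2) * ((Real.sin β : ℂ) * star (wignerD n M' M α β γ) *
        fockRotation S α β γ x.1 x.2) = (Real.sin β : ℂ) * (star (reducedWigner n M' M β) *
      matrixElement ψ (NormedSpace.exp ((-Complex.I * (β : ℂ)) • secondQuantized S spinY)) φ) := by
    intro α β γ
    have h1 : ∑ x : Finset (Mode S) × Finset (Mode S),
      (star (ψ x.1) * φ x.2) * ((Real.sin β : ℂ) * star (wignerD n M' M α β γ) *
        fockRotation S α β γ x.1 x.2) = (Real.sin β : ℂ) * star (wignerD n M' M α β γ) *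
        matrixElement ψ (fockRotation S α β γ) φ := by
      rw [hexp, Finset.mul_sum]
      exact Finset.sum_congr rfl fun _ _ => by ring
    have h2 : matrixElement ψ (fockRotation S α β γ) φ = _ :=
      dotProduct_eulerRotation_mulVec (secondQuantized_isHermitian S spinZ_isHermitian)
        (secondQuantized S spinY) hψ hφ α β γ
    have h3 := star_exp_mul_exp α (M' / 2)
    have h4 := star_exp_mul_exp γ (M / 2)
    rw [h1, h2, wignerD_eq, star_mul', star_mul', ← matrixElement]
    linear_combination (Real.sin β : ℂ) * star (reducedWigner n M' M β) *
      matrixElement ψ (NormedSpace.exp ((-Complex.I * (β : ℂ)) • secondQuantized S spinY)) φ *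
      (star (Complex.exp (-Complex.I * γ * ((M / 2 : ℝ) : ℂ))) *
        Complex.exp (-Complex.I * γ * ((M / 2 : ℝ) : ℂ)) * h3 + h4)
  simp only [hpoint, intervalIntegral.integral_const, intervalIntegral.integral_smul] at hint
  rw [hexp]
  simp only [projection, Matrix.of_apply]
  rw [wignerCoeff]
  rw [Finset.sum_congr rfl fun x _ => mul_left_comm _ _ _, ← Finset.mul_sum, ← hint]
  have : (Real.pi : ℂ) ≠ 0 := by exact_mod_cast Real.pi_ne_zero
  simp only [Complex.real_smul]
  push_cast
  field_simp
  ring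

/-! ### Expansions in reduced Wigner functions -/

theorem wignerCoeff_reducedWigner (n c : ℕ) (M' M : ℤ) :
    wignerCoeff n M' M (reducedWigner c M' M) =
      open Classical in
      if n = c ∧ (∃ k, twoM n k = M') ∧ ∃ l, twoM n l = M then 1 else 0 := by
  rw [wignerCoeff]
  split_ifs with h
  · obtain ⟨rfl, ⟨k, rfl⟩, ⟨l, rfl⟩⟩ := h
    rw [integral_reducedWigner_mul, if_pos rfl]
    have : (n : ℂ) + 1 ≠ 0 := by exact_mod_cast Nat.succ_ne_zero n
    field_simp
  · by_cases h1 : ∃ k, twoM n k = M'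
    · by_cases h2 : ∃ l, twoM n l = M
      · have hc : n ≠ c := fun hc => h ⟨hc, h1, h2⟩
        obtain ⟨k, rfl⟩ := h1
        obtain ⟨l, rfl⟩ := h2
        rw [integral_reducedWigner_mul, if_neg hc, mul_zero]
      · push Not at h2
        simp [reducedWigner_eq_zero_right h2]
    · push Not at h1
      simp [reducedWigner_eq_zero_left h1]

theorem wignerCoeff_sum {κ : Type*} (n : ℕ) (M' M : ℤ) (s : Finset κ) (w : κ → ℂ) (c : κ → ℕ) :
    wignerCoeff n M' M (fun β => ∑ i ∈ s, w i * reducedWigner (c i) M' M β) =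
      ∑ i ∈ s, w i * wignerCoeff n M' M (reducedWigner (c i) M' M) := by
  have h1 : ∀ β : ℝ, (Real.sin β : ℂ) * (star (reducedWigner n M' M β) *
      ∑ i ∈ s, w i * reducedWigner (c i) M' M β) = ∑ i ∈ s, w i * ((Real.sin β : ℂ) *
      (star (reducedWigner n M' M β) * reducedWigner (c i) M' M β)) := by
    intro β
    rw [Finset.mul_sum, Finset.mul_sum]
    exact Finset.sum_congr rfl fun _ _ => by ring
  have hc := fun c => continuous_reducedWigner c M' M
  simp only [wignerCoeff, h1]
  rw [integral_sum_mul _ _ _ fun i => ?_, Finset.mul_sum]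
  · exact Finset.sum_congr rfl fun _ _ => by ring
  · have h2 := hc (c i)
    have h3 := hc n
    fun_prop

/-- Orthogonality recovers the coefficients of any finite expansion. Where a state does not exist,
`d^n` is zero, and replacing the given coefficient by `0` changes nothing. -/
theorem exists_wigner_expansion {f : ℝ → ℂ} {M' M : ℤ}
    (hf : f ∈ Submodule.span ℂ (Set.range fun n => reducedWigner n M' M)) :
    ∃ s : Finset ℕ, (∀ n ∉ s, wignerCoeff n M' M f = 0) ∧
      f = fun β => ∑ n ∈ s, wignerCoeff n M' M f * reducedWigner n M' M β := by
  obtain ⟨w, rfl⟩ := (Finsupp.mem_span_range_iff_exists_finsupp).1 hf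
  have he : (w.sum fun n a => a • reducedWigner n M' M) =
      fun β => ∑ n ∈ w.support, w n * reducedWigner n M' M β := by
    ext β
    simp [Finsupp.sum]
  rw [he]
  have hcoeff : ∀ n, wignerCoeff n M' M (fun β => ∑ n ∈ w.support, w n * reducedWigner n M' M β) =
      w n * wignerCoeff n M' M (reducedWigner n M' M) := by
    intro n
    rw [wignerCoeff_sum n M' M w.support w fun n => n, Finset.sum_eq_single n]
    · intro m _ hm
      rw [wignerCoeff_reducedWigner, if_neg (fun h => hm h.1.symm), mul_zero]
    · intro hn
      rw [Finsupp.notMem_support_iff.1 hn, zero_mul]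
  refine ⟨w.support, fun n hn => ?_, ?_⟩
  · rw [hcoeff, Finsupp.notMem_support_iff.1 hn, zero_mul]
  · ext β
    refine Finset.sum_congr rfl fun n _ => ?_
    rw [hcoeff, wignerCoeff_reducedWigner]
    by_cases h1 : ∃ k, twoM n k = M'
    · by_cases h2 : ∃ l, twoM n l = M
      · rw [if_pos ⟨rfl, h1, h2⟩, mul_one]
      · push Not at h2
        simp [reducedWigner_eq_zero_right h2]
    · push Not at h1
      simp [reducedWigner_eq_zero_left h1]

theorem reducedWigner_mul_mem_span (n : ℕ) (M₁' M₁ M₂' M₂ : ℤ) {f : ℝ → ℂ}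
    (hf : f ∈ Submodule.span ℂ (Set.range fun n => reducedWigner n M₂' M₂)) :
    reducedWigner n M₁' M₁ * f ∈
      Submodule.span ℂ (Set.range fun n => reducedWigner n (M₁' + M₂') (M₁ + M₂)) := by
  induction hf using Submodule.span_induction with
  | mem f hf =>
    obtain ⟨b, rfl⟩ := hf
    have h : reducedWigner n M₁' M₁ * reducedWigner b M₂' M₂ =
        ∑ c ∈ Finset.range (n + b + 1), (clebschGordan n M₁' b M₂' c (M₁' + M₂') *
          clebschGordan n M₁ b M₂ c (M₁ + M₂)) • reducedWigner c (M₁' + M₂') (M₁ + M₂) := by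
      ext β
      rw [Pi.mul_apply, reducedWigner_mul, Finset.sum_apply]
      rfl
    simp only [h]
    exact Submodule.sum_mem _ fun c _ => Submodule.smul_mem _ _ (Submodule.subset_span ⟨c, rfl⟩)
  | zero => simp
  | add f g _ _ hf hg => rw [mul_add]; exact Submodule.add_mem _ hf hg
  | smul a f _ hf => rw [mul_smul_comm]; exact Submodule.smul_mem _ _ hf

theorem prod_reducedWigner_mem_span (n : ℕ) {p : ℕ} (m' m : Fin p → Fin (n + 1)) :
    (fun β => ∏ i, reducedWigner n (twoM n (m' i)) (twoM n (m i)) β) ∈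
      Submodule.span ℂ (Set.range fun c => reducedWigner c (totalTwoM m') (totalTwoM m)) := by
  induction p with
  | zero =>
    -- The empty product is the constant `1 = d^0_{00}`.
    refine Submodule.subset_span ⟨0, ?_⟩
    ext β
    have h := reducedWigner_twoM 0 0 0 β
    have hY : spinY 0 = 0 := by
      ext k l
      simp [spinY, spinMinus_apply, spinPlus]
    rw [show twoM 0 0 = 0 by simp [twoM], hY] at h
    simpa [totalTwoM] using h
  | succ p ih =>
    have h := reducedWigner_mul_mem_span n (twoM n (m' 0)) (twoM n (m 0)) _ _
      (ih (fun i => m' i.succ) (fun i => m i.succ))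
    have h1 : ∀ l : Fin (p + 1) → Fin (n + 1),
        totalTwoM l = twoM n (l 0) + totalTwoM fun i => l i.succ := fun l => by
      simp [totalTwoM, Fin.sum_univ_succ]
    simp only [Fin.prod_univ_succ, h1 m, h1 m']
    exact h

theorem matrixElement_rotation_mem_span {N : Type*} {S : Finset (Shell N)} [LinearOrder (Mode S)]
    (s : S) {p : ℕ} (m m' : Fin p → Fin (s.1.twoJ + 1)) :
    (fun β : ℝ => matrixElement (stateOf S (creator S s m'))
      (NormedSpace.exp ((-Complex.I * (β : ℂ)) • secondQuantized S spinY))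
      (stateOf S (creator S s m))) ∈
      Submodule.span ℂ (Set.range fun c => reducedWigner c (totalTwoM m') (totalTwoM m)) := by
  have h : (fun β : ℝ => matrixElement (stateOf S (creator S s m'))
      (NormedSpace.exp ((-Complex.I * (β : ℂ)) • secondQuantized S spinY))
      (stateOf S (creator S s m))) = ∑ L : Fin p → Fin (s.1.twoJ + 1),
      (star (stateOf S (creator S s m')) ⬝ᵥ stateOf S (creator S s L)) • fun β =>
        ∏ i, reducedWigner s.1.twoJ (twoM s.1.twoJ (L i)) (twoM s.1.twoJ (m i)) β := by
    ext β
    rw [matrixElement_exp_secondQuantized, Finset.sum_apply]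
    refine Finset.sum_congr rfl fun L _ => ?_
    simp only [Pi.smul_apply, smul_eq_mul, reducedWigner_twoM]
    ring
  rw [h]
  refine Submodule.sum_mem _ fun L _ => ?_
  -- Configurations `L` with another total magnetic number lie in a different span, but their
  -- overlap with the bra is zero.
  by_cases hL : totalTwoM m' = totalTwoM L
  · rw [hL]
    exact Submodule.smul_mem _ _ (prod_reducedWigner_mem_span _ L m)
  · rw [star_stateOf_creator_dotProduct_of_ne s hL, zero_smul]
    exact Submodule.zero_mem _

/-- The coefficients of a product of two functions in terms of those of the factors. -/
theorem wignerCoeff_mul {f g : ℝ → ℂ} {M₁' M₁ M₂' M₂ : ℤ} {s t : Finset ℕ} {u v : ℕ → ℂ}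
    (hf : f = fun β => ∑ n ∈ s, u n * reducedWigner n M₁' M₁ β)
    (hg : g = fun β => ∑ n ∈ t, v n * reducedWigner n M₂' M₂ β) (n : ℕ) :
    wignerCoeff n (M₁' + M₂') (M₁ + M₂) (fun β => f β * g β) =
      ∑ x ∈ s ×ˢ t, u x.1 * v x.2 * (clebschGordan x.1 M₁' x.2 M₂' n (M₁' + M₂') *
        clebschGordan x.1 M₁ x.2 M₂ n (M₁ + M₂)) := by
  have h1 : (fun β => f β * g β) = fun β =>
      ∑ y ∈ (s ×ˢ t).sigma fun x => Finset.range (x.1 + x.2 + 1), (u y.1.1 * v y.1.2 *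
        (clebschGordan y.1.1 M₁' y.1.2 M₂' y.2 (M₁' + M₂') *
        clebschGordan y.1.1 M₁ y.1.2 M₂ y.2 (M₁ + M₂))) *
        reducedWigner y.2 (M₁' + M₂') (M₁ + M₂) β := by
    ext β
    rw [hf, hg, Finset.sum_mul_sum, ← Finset.sum_product', Finset.sum_sigma]
    refine Finset.sum_congr rfl fun x _ => ?_
    rw [mul_mul_mul_comm, reducedWigner_mul, Finset.mul_sum]
    exact Finset.sum_congr rfl fun c _ => by ring
  rw [h1, wignerCoeff_sum _ _ _ _ _ fun y : (_ : ℕ × ℕ) × ℕ => y.2, Finset.sum_sigma]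
  refine Finset.sum_congr rfl fun x _ => ?_
  -- Orthogonality selects `c = n`. If `n` is beyond the range of the series, the triangle condition
  -- fails; if `|J M⟩` or `|J M'⟩` does not exist, a Clebsch–Gordan coefficient is zero as well.
  rw [Finset.sum_eq_single n]
  · rw [wignerCoeff_reducedWigner]
    by_cases h1 : ∃ k, twoM n k = M₁' + M₂'
    · by_cases h2 : ∃ l, twoM n l = M₁ + M₂
      · rw [if_pos ⟨rfl, h1, h2⟩, mul_one]
      · push Not at h2
        simp [clebschGordan_eq_zero h2]
    · push Not at h1
      simp [clebschGordan_eq_zero h1]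
  · intro c _ hc
    rw [wignerCoeff_reducedWigner, if_neg (fun h => hc h.1.symm), mul_zero]
  · intro hn
    rw [clebschGordan_of_not_triangle, zero_mul, mul_zero, zero_mul]
    rintro ⟨-, -, -, h⟩
    exact hn (Finset.mem_range.2 (Nat.lt_succ_of_le h))

theorem theorem1 {N : Type*} (S : Finset (Shell N)) [LinearOrder (Mode S)] (s₁ s₂ : S)
    (h : s₁.1.twoJ ≠ s₂.1.twoJ ∨ (s₁.1.twoJ = s₂.1.twoJ ∧ s₁.1.ν ≠ s₂.1.ν))
    {p q : ℕ} (m₁ m₁' : Fin p → Fin (s₁.1.twoJ + 1)) (m₂ m₂' : Fin q → Fin (s₂.1.twoJ + 1))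
    (φ₁ φ₁' φ₂ φ₂' φ φ' : Finset (Mode S) → ℂ)
    (hφ₁ : φ₁ = stateOf S (creator S s₁ m₁)) (hφ₁' : φ₁' = stateOf S (creator S s₁ m₁'))
    (hφ₂ : φ₂ = stateOf S (creator S s₂ m₂)) (hφ₂' : φ₂' = stateOf S (creator S s₂ m₂'))
    (hφ : φ = stateOf S (creator S s₁ m₁ * creator S s₂ m₂))
    (hφ' : φ' = stateOf S (creator S s₁ m₁' * creator S s₂ m₂'))
    (M₁ M₁' M₂ M₂' M M' : ℤ)
    (hM₁ : M₁ = totalTwoM m₁) (hM₁' : M₁' = totalTwoM m₁')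
    (hM₂ : M₂ = totalTwoM m₂) (hM₂' : M₂' = totalTwoM m₂')
    (hM : M = M₁ + M₂) (hM' : M' = M₁' + M₂')
    (J : ℕ) (term : ℕ × ℕ → ℂ)
    (hterm : ∀ J₁ J₂ : ℕ, term (J₁, J₂) =
      matrixElement φ₁' (projection S J₁ M₁' M₁) φ₁ *
        matrixElement φ₂' (projection S J₂ M₂' M₂) φ₂ *
          (clebschGordan J₁ M₁' J₂ M₂' J M' * clebschGordan J₁ M₁ J₂ M₂ J M)) :
    (Function.support term).Finite ∧
      matrixElement φ' (projection S J M' M) φ = ∑ᶠ x : ℕ × ℕ, term x := by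
  have hs : s₁ ≠ s₂ := by
    rintro rfl
    rcases h with h | h
    · exact h rfl
    · exact h.2 rfl
  subst hφ₁ hφ₁' hφ₂ hφ₂' hφ hφ' hM₁ hM₁' hM₂ hM₂' hM hM'
  obtain ⟨a, ha, hfa⟩ := exists_wigner_expansion (matrixElement_rotation_mem_span s₁ m₁ m₁')
  obtain ⟨b, hb, hfb⟩ := exists_wigner_expansion (matrixElement_rotation_mem_span s₂ m₂ m₂')
  have hP₁ := fun n => matrixElement_projection S n
    (secondQuantized_spinZ_mulVec_stateOf s₁ m₁') (secondQuantized_spinZ_mulVec_stateOf s₁ m₁)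
  have hP₂ := fun n => matrixElement_projection S n
    (secondQuantized_spinZ_mulVec_stateOf s₂ m₂') (secondQuantized_spinZ_mulVec_stateOf s₂ m₂)
  simp only [hP₁, hP₂] at hterm
  -- A nonzero term needs both projector matrix elements nonzero, so it lies in the product of the
  -- two finite sets of expansion indices.
  have hsupp : Function.support term ⊆ (a ×ˢ b : Finset (ℕ × ℕ)) := by
    rintro ⟨J₁, J₂⟩ hx
    rw [Function.mem_support, hterm] at hx
    rw [Finset.mem_coe, Finset.mem_product]
    constructor
    · by_contra h1
      exact hx (by rw [ha _ h1]; simp)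
    · by_contra h2
      exact hx (by rw [hb _ h2]; simp)
  refine ⟨(Finset.finite_toSet _).subset hsupp, ?_⟩
  rw [finsum_eq_sum_of_support_subset _ hsupp, matrixElement_projection S J
    (secondQuantized_spinZ_mulVec_stateOf_mul s₁ s₂ m₁' m₂')
    (secondQuantized_spinZ_mulVec_stateOf_mul s₁ s₂ m₁ m₂)]
  simp only [matrixElement_exp_secondQuantized_mul _ _ hs]
  rw [wignerCoeff_mul hfa hfb]
  exact Finset.sum_congr rfl fun x _ => (hterm x.1 x.2).symm

end
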